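/- Let $W$ be a Coxeter group with simple generators $S$, length function $\ell$ and set of reflections $T=\{wsw^{-1} : w\in W,\ s\in S\}$. Assume that $W$ is right-angled (any two distinct simple generators either commute or generate an infinite dihedral group) or that $W$ is a symmetric group $\mathfrak S_n$ with the adjacent transpositions as simple generators. The undirected Bruhat graph $\Gamma$ is the simple graph on $W$ in which $x$ and $xt$ are joined by an edge for all $x\in W$ and $t\in T$. The Bruhat order $\leq$ on $W$ is the reflexive transitive closure of the relations $x\to xt$ with $t\in T$ and $\ell(xt)>\ell(x)$. Let $u\leq v$ in $W$, let $[u,v]=\{w\in W : u\leq w\leq v\}$, let $\Gamma(u,v)$ be the restriction of $\Gamma$ to the vertex set $[u,v]$, and let $H([u,v])$ be the Hasse diagram of $[u,v]$, i.e. the undirected graph on $[u,v]$ whose edges are the pairs $\{x,y\}$ with $x\lessdot y$ a cover relation of the poset $[u,v]$. A perfect matching of a graph is a fixed-point-free involution $M$ of its vertex set such that $\{x,M(x)\}$ is an edge for every vertex $x$. A perfect matching $M$ of $H([u,v])$ is a special matching if for every cover relation $x\lessdot y$ in $[u,v]$ either $M(x)=y$ or $M(x)<M(y)$. Then every perfect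 matching of $H([u,v])$ that is an automorphism of the graph $\Gamma(u,v)$ is a special matching. -/

import Mathlib

namespace CoxeterSystem

variable {B : Type*} {W : Type*} [Group W] {M : CoxeterMatrix B} (cs : CoxeterSystem M W)

/-- The directed Bruhat graph of the Coxeter group `W`: there is a directed edge `x → x t`
whenever `t` is a reflection (a conjugate of a simple reflection) with `ℓ(x t) > ℓ(x)`. -/
def BruhatEdge (x y : W) : Prop :=
  ∃ t : W, cs.IsReflection t ∧ y = x * t ∧ cs.length x < cs.length y

/-- The (strong) Bruhat order: the reflexive transitive closure of the relation given by the
directed edges of the Bruhat graph. -/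
def BruhatLE (x y : W) : Prop :=
  Relation.ReflTransGen cs.BruhatEdge x y

theorem BruhatLE.eq_or_length_lt {x y : W} (h : cs.BruhatLE x y) :
    x = y ∨ cs.length x < cs.length y := by
  induction h with
  | refl => exact Or.inl rfl
  | tail _ hbc ih =>
    obtain ⟨_, _, _, hlt⟩ := hbc
    rcases ih with rfl | ih
    · exact Or.inr hlt
    · exact Or.inr (ih.trans hlt)

/-- The Bruhat order as a partial order on `W`. -/
abbrev bruhatOrder : PartialOrder W where
  le := cs.BruhatLE
  le_refl _ := Relation.ReflTransGen.refl
  le_trans _ _ _ h h' := Relation.ReflTransGen.trans h h'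
  le_antisymm x y h h' := by
    rcases BruhatLE.eq_or_length_lt cs h with e | h1
    · exact e
    · rcases BruhatLE.eq_or_length_lt cs h' with e | h2
      · exact e.symm
      · exact absurd h1 h2.asymm

/-- The Bruhat interval `[u, v] = {w ∈ W | u ≤ w ≤ v}`. -/
def BruhatInterval (u v : W) : Type _ :=
  {w : W // cs.BruhatLE u w ∧ cs.BruhatLE w v}

/-- The Bruhat interval `[u, v]` is a poset under the restriction of the Bruhat order. -/
instance instPartialOrderBruhatInterval (u v : W) : PartialOrder (cs.BruhatInterval u v) :=
  @PartialOrder.lift _ W cs.bruhatOrder Subtype.val Subtype.val_injective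

/-- The undirected Bruhat graph `Γ` of `W`: the simple undirected graph underlying the directed
Bruhat graph. -/
def bruhatGraph : SimpleGraph W :=
  SimpleGraph.fromRel cs.BruhatEdge

/-- The undirected Bruhat graph `Γ(u, v)`: the restriction of `Γ` to the vertex set `[u, v]`. -/
def bruhatIntervalGraph (u v : W) : SimpleGraph (cs.BruhatInterval u v) :=
  cs.bruhatGraph.comap Subtype.val

/-- The Coxeter group is right-angled: any two distinct simple generators `s`, `s'` either commute
(`m(s, s') = 2`) or generate an infinite dihedral group (`m(s, s') = ∞`, which Mathlib encodes by
the entry `0` of the Coxeter matrix). -/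
def IsRightAngled (_cs : CoxeterSystem M W) : Prop :=
  ∀ i j : B, i ≠ j → M i j = 2 ∨ M i j = 0

/-- The Coxeter group is a symmetric group, with its standard Coxeter generators: for some `n` it
is isomorphic to the group of permutations of `{0, …, n - 1}`, in such a way that the simple
generators correspond to the adjacent transpositions. -/
def IsSymmetricGroup : Prop :=
  ∃ (n : ℕ) (φ : W ≃* Equiv.Perm (Fin n)),
    φ '' Set.range cs.simple =
      {σ | ∃ (i : ℕ) (h : i + 1 < n), σ = Equiv.swap ⟨i, i.lt_succ_self.trans h⟩ ⟨i + 1, h⟩}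

end CoxeterSystem

/-- A perfect matching of a graph `G`: a fixed-point-free involution `f` of the vertex set such
that `x` and `f x` are joined by an edge for every vertex `x`. -/
structure IsPerfectMatchingMap {V : Type*} (G : SimpleGraph V) (f : V → V) : Prop where
  involutive : Function.Involutive f
  apply_ne : ∀ x, f x ≠ x
  adj : ∀ x, G.Adj x (f x)

/-- A special matching of a poset `P`: a perfect matching `f` of the Hasse diagram of `P` such
that every cover relation `x ⋖ y` satisfies `f x = y` or `f x < f y`. -/
structure IsSpecialMatching {P : Type*} [PartialOrder P] (f : P → P) : Prop where
  isPerfectMatching : IsPerfectMatchingMap (SimpleGraph.hasse P) f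
  eq_or_lt : ∀ x y : P, x ⋖ y → f x = y ∨ f x < f y

/-!
A perfect matching `f` of the Hasse diagram that preserves adjacency in the Bruhat graph sends a
cover `x ⋖ y` with `f x ≠ y` to an edge between `f x` and `f y`. Comparing lengths, this edge can
only point the wrong way if `f` goes up from `x` and down from `y`. Then `x, f y` and `y, f x`
form a *butterfly* `IsButterfly`: two elements with two common covers, such that `f` matches the
bottom with the top (`isSpecialMatching_of_not_isButterfly`). It remains to exclude such
butterflies, in each of the two families of groups.

The general tool is that left multiplication by a simple reflection `s` maps each edge `x → y` of
the directed Bruhat graph with `y ≠ s x` to an edge `s x → s y` (`BruhatEdge.simple_mul`). It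
comes from the strong exchange property, proved here with the usual sign cocycle, and it yields
the lifting property, the gradedness of the Bruhat order by the length (`BruhatLE.exists_cov`) and
the thinness of intervals of length two (`not_three_mid`).

*Right-angled groups.* The key fact is that if `s` is not a left descent of `w`, then it is a left
descent of at most one element covered by `w` (`IsRightAngled.cov_unique`). By induction along
left descents it follows that two elements have at most two common covers
(`IsRightAngled.not_three_covers`), that every upper bound of the top `y, y'` of a butterfly is
above a common cover `q` of `y` and `y'` (`IsRightAngled.exists_common_cover`), and that an
element covering `q` and adjacent to the bottom of the butterfly covers a second common cover `p`
of `y` and `y'` (`IsRightAngled.exists_other_common_cover`). If `f` matches the bottom of a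
butterfly in the interval with its top, then `q` lies in the interval, and `f q` is adjacent to
the bottom; it cannot be a third common cover of the bottom, so it covers `q`. Hence `p` lies in
the interval as well, and `p, q` with `f p, f q` is a butterfly of the same kind further up, which
cannot go on forever.

*Symmetric groups.* A butterfly consists of the permutations of intermediate length among the six
arrangements of three values at three positions `i < j < k`
(`IsStandardIso.exists_isHexagonMiddle`). The increasing arrangement `p` is above every common
lower bound of the bottom of the butterfly (`IsStandardIso.le_of_le_swap`), so it belongs to the
interval. It is adjacent to both bottom elements, hence `f p` is adjacent to both top elements,
and as a three-cycle is a product of two transpositions in only three ways, `f p` is a bottom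
element of the butterfly or the decreasing arrangement. The former are matched with the top, and
the latter is too long.
-/

namespace CoxeterSystem

/-! ### The reflection cocycle and strong exchange -/

variable {B : Type*} {W : Type*} [Group W] {M : CoxeterMatrix B} (cs : CoxeterSystem M W)

open Classical in
/-- The action of the `i`-th simple reflection on `W × ZMod 2`: conjugation on the first
coordinate, and a flip of the sign over the simple reflection itself. -/
noncomputable def signedConj (i : B) : Function.End (W × ZMod 2) := fun p =>
  (cs.simple i * p.1 * cs.simple i, p.2 + if p.1 = cs.simple i then 1 else 0)

open Classical in
/-- Over `k` rounds of `s_i s_j`, the sign of `t` is flipped once for each occurrence of `t` among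
the elements `s_j (s_i s_j) ^ r`, `r < 2 * k`. For `k = m(i, j)` this sequence runs through a period
twice, so that the braid relations hold. -/
theorem signedConj_mul_pow_apply (i j : B) (k : ℕ) (p : W × ZMod 2) :
    ((cs.signedConj i * cs.signedConj j) ^ k) p =
      ((cs.simple i * cs.simple j) ^ k * p.1 * ((cs.simple i * cs.simple j) ^ k)⁻¹,
        p.2 + ∑ r ∈ Finset.range (2 * k),
          if p.1 = cs.simple j * (cs.simple i * cs.simple j) ^ r then 1 else 0) := by
  induction k with
  | zero => simp; rfl
  | succ k ih =>
    rw [pow_succ']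
    change (cs.signedConj i * cs.signedConj j) (((cs.signedConj i * cs.signedConj j) ^ k) p) = _
    rw [ih]
    set g := cs.simple i * cs.simple j with hg
    have hflip : ∀ n : ℕ, cs.simple j * g ^ n = (g ^ n)⁻¹ * cs.simple j := by
      intro n
      have : cs.simple j * g * (cs.simple j)⁻¹ = g⁻¹ := by simp [hg, mul_assoc]
      rw [← inv_pow, ← this, conj_pow]; simp [mul_assoc]
    have e1 : (g ^ k * p.1 * (g ^ k)⁻¹ = cs.simple j) ↔ p.1 = cs.simple j * g ^ (2 * k) := by
      rw [two_mul, pow_add, ← mul_assoc, hflip]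
      constructor
      · intro h; rw [← h]; group
      · intro h; rw [h]; group
    have e2 : (cs.simple j * (g ^ k * p.1 * (g ^ k)⁻¹) * cs.simple j = cs.simple i) ↔
        p.1 = cs.simple j * g ^ (2 * k + 1) := by
      have : (cs.simple j * g ^ (2 * k + 1)) = (g ^ k)⁻¹ * (cs.simple j * g) * g ^ k := by
        rw [show 2 * k + 1 = k + (1 + k) by ring, pow_add, ← mul_assoc, hflip, pow_add, pow_one]
        simp only [mul_assoc]
      rw [this]
      constructor
      · intro h
        have : cs.simple j * g = g ^ k * p.1 * (g ^ k)⁻¹ := calc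
          cs.simple j * g = cs.simple j * cs.simple i * cs.simple j := by rw [hg, mul_assoc]
          _ = g ^ k * p.1 * (g ^ k)⁻¹ := by rw [← h]; simp [mul_assoc]
        rw [this]; group
      · intro h; rw [h]; simp [hg, mul_assoc]
    rw [show 2 * (k + 1) = 2 * k + 1 + 1 by ring, Finset.sum_range_succ, Finset.sum_range_succ]
    change (cs.simple i * (cs.simple j * (g ^ k * p.1 * (g ^ k)⁻¹) * cs.simple j) * cs.simple i,
      (p.2 + _ + if g ^ k * p.1 * (g ^ k)⁻¹ = cs.simple j then 1 else 0) +
        if cs.simple j * (g ^ k * p.1 * (g ^ k)⁻¹) * cs.simple j = cs.simple i then 1 else 0) = _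
    rw [Prod.mk.injEq]
    constructor
    · rw [pow_succ', hg]; simp [mul_assoc]
    · simp only [e1, e2, add_assoc]

theorem isLiftable_signedConj : M.IsLiftable cs.signedConj := by
  classical
  intro i j
  funext p
  rw [signedConj_mul_pow_apply]
  have hg := cs.simple_mul_simple_pow i j
  have : (2 : ZMod 2) = 0 := by decide
  simp only [hg, two_mul, Finset.sum_range_add, pow_add, one_mul, ← Finset.sum_add_distrib]
  simp [← two_mul, this]
  rfl

/-- The reflection cocycle: `cs.reflCocycle w t` is the parity of the number of occurrences of
`t` among the right inversions attached to any word for `w`. -/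
noncomputable def reflCocycle (w t : W) : ZMod 2 :=
  (cs.lift ⟨cs.signedConj, cs.isLiftable_signedConj⟩ w (t, 0)).2

theorem lift_signedConj_apply (w : W) (p : W × ZMod 2) :
    cs.lift ⟨cs.signedConj, cs.isLiftable_signedConj⟩ w p =
      (w * p.1 * w⁻¹, p.2 + cs.reflCocycle w p.1) := by
  classical
  unfold reflCocycle
  induction w using cs.simple_induction_left generalizing p with
  | one =>
    rw [map_one]
    change p = (_, p.2 + (0 : ZMod 2))
    simp
  | mul_simple_left w i ih =>
    rw [map_mul, lift_apply_simple]
    change cs.signedConj i (cs.lift ⟨cs.signedConj, cs.isLiftable_signedConj⟩ w p) =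
      (_, _ + (cs.signedConj i (cs.lift ⟨cs.signedConj, cs.isLiftable_signedConj⟩ w _)).2)
    rw [ih p, ih (p.1, 0)]
    simp [signedConj, mul_assoc, add_assoc]

theorem reflCocycle_mul (w w' t : W) :
    cs.reflCocycle (w * w') t = cs.reflCocycle w' t + cs.reflCocycle w (w' * t * w'⁻¹) := by
  have h := cs.lift_signedConj_apply (w * w') (t, 0)
  rw [map_mul] at h
  change cs.lift ⟨cs.signedConj, cs.isLiftable_signedConj⟩ w
    (cs.lift ⟨cs.signedConj, cs.isLiftable_signedConj⟩ w' (t, 0)) = _ at h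
  rw [lift_signedConj_apply, lift_signedConj_apply] at h
  simpa using (congrArg Prod.snd h).symm

@[simp]
theorem reflCocycle_one (t : W) : cs.reflCocycle 1 t = 0 := by
  simp [reflCocycle]; rfl

open Classical in
theorem reflCocycle_simple (i : B) (t : W) :
    cs.reflCocycle (cs.simple i) t = if t = cs.simple i then 1 else 0 := by
  simp [reflCocycle, signedConj]

theorem reflCocycle_self {t : W} (ht : cs.IsReflection t) : cs.reflCocycle t t = 1 := by
  obtain ⟨w, i, rfl⟩ := ht
  have h0 := cs.reflCocycle_mul w w⁻¹ (w * cs.simple i * w⁻¹)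
  have h1 := cs.reflCocycle_mul (w * cs.simple i) w⁻¹ (w * cs.simple i * w⁻¹)
  have h2 := cs.reflCocycle_mul w (cs.simple i) (cs.simple i)
  have e : w⁻¹ * (w * cs.simple i * w⁻¹) * w⁻¹⁻¹ = cs.simple i := by group
  rw [e] at h0 h1
  rw [h1, h2]
  simp only [mul_inv_cancel, reflCocycle_one] at h0
  simp only [reflCocycle_simple, if_true, inv_simple, simple_mul_simple_cancel_right]
  linear_combination -h0

theorem mem_rightInvSeq_of_reflCocycle_ne_zero (ω : List B) {t : W}
    (h : cs.reflCocycle (cs.wordProd ω) t ≠ 0) : t ∈ cs.rightInvSeq ω := by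
  classical
  induction ω with
  | nil => simp at h
  | cons i ω ih =>
    rw [wordProd_cons, reflCocycle_mul, reflCocycle_simple] at h
    rw [rightInvSeq, List.mem_cons]
    by_cases h' : cs.wordProd ω * t * (cs.wordProd ω)⁻¹ = cs.simple i
    · left; rw [← h']; group
    · right; apply ih; simpa [h'] using h

/-- The right inversions of `w` are detected by the reflection cocycle; this is the strong exchange
property. -/
theorem length_mul_lt_iff_reflCocycle {w t : W} (ht : cs.IsReflection t) :
    cs.length (w * t) < cs.length w ↔ cs.reflCocycle w t ≠ 0 := by
  have key : ∀ w : W, cs.reflCocycle w t ≠ 0 → cs.length (w * t) < cs.length w := by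
    intro w h
    obtain ⟨ω, hω, rfl⟩ := cs.exists_isReduced w
    exact (cs.isRightInversion_of_mem_rightInvSeq hω
      (cs.mem_rightInvSeq_of_reflCocycle_ne_zero ω h)).2
  refine ⟨fun h h0 => ?_, key w⟩
  have := key (w * t) (by
    rw [reflCocycle_mul, reflCocycle_self cs ht, mul_inv_cancel_right, h0]; simp)
  rw [mul_assoc, ht.mul_self, mul_one] at this
  exact absurd h this.asymm

/-- Left inversions other than `s` are transported from `w` to `s w` by conjugation with the simple
reflection `s`. -/
theorem length_simple_mul_refl_mul_lt_iff {w t : W} (ht : cs.IsReflection t) {i : B}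
    (hti : t ≠ cs.simple i) :
    cs.length (cs.simple i * (t * w)) < cs.length (cs.simple i * w) ↔
      cs.length (t * w) < cs.length w := by
  have h1 := cs.length_mul_lt_iff_reflCocycle (w := w⁻¹) ht
  have ht' : cs.IsReflection (cs.simple i * t * cs.simple i) := by
    simpa using ht.conj (cs.simple i)
  have h2 := cs.length_mul_lt_iff_reflCocycle (w := w⁻¹ * cs.simple i) ht'
  rw [← cs.length_inv (t * w), ← cs.length_inv w, ← cs.length_inv (cs.simple i * (t * w)),
    ← cs.length_inv (cs.simple i * w), mul_inv_rev, mul_inv_rev, mul_inv_rev,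
    ht.inv, inv_simple, h1]
  have e : w⁻¹ * cs.simple i * (cs.simple i * t * cs.simple i) = w⁻¹ * t * cs.simple i := by
    simp [mul_assoc]
  rw [e] at h2
  rw [h2, reflCocycle_mul, reflCocycle_simple, if_neg, zero_add]
  · have : cs.simple i * (cs.simple i * t * cs.simple i) * (cs.simple i)⁻¹ = t := by
      simp [mul_assoc]
    rw [this]
  · intro h
    apply hti
    have h' := congrArg (fun z => cs.simple i * z * cs.simple i) h
    simpa [mul_assoc] using h'

/-! ### Bruhat edges, lifting and covers -/

theorem bruhatEdge_iff_left {x y : W} :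
    cs.BruhatEdge x y ↔ ∃ t, cs.IsReflection t ∧ y = t * x ∧ cs.length x < cs.length y := by
  constructor
  · rintro ⟨t, ht, rfl, h⟩
    exact ⟨x * t * x⁻¹, ht.conj x, by group, h⟩
  · rintro ⟨t, ht, rfl, h⟩
    exact ⟨x⁻¹ * t * x, by simpa using ht.conj x⁻¹, by group, h⟩

variable {cs}

theorem BruhatEdge.length_lt {x y : W} (h : cs.BruhatEdge x y) : cs.length x < cs.length y := by
  obtain ⟨_, _, _, h⟩ := h; exact h

theorem BruhatEdge.ne {x y : W} (h : cs.BruhatEdge x y) : x ≠ y := by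
  rintro rfl; exact lt_irrefl _ h.length_lt

theorem BruhatEdge.le {x y : W} (h : cs.BruhatEdge x y) : cs.BruhatLE x y := .single h

theorem BruhatLE.trans {x y z : W} (h : cs.BruhatLE x y) (h' : cs.BruhatLE y z) :
    cs.BruhatLE x z := Relation.ReflTransGen.trans h h'

theorem BruhatLE.length_le {x y : W} (h : cs.BruhatLE x y) : cs.length x ≤ cs.length y := by
  rcases BruhatLE.eq_or_length_lt cs h with rfl | h
  exacts [le_rfl, h.le]

/-- Left multiplication by a simple reflection `s` preserves every directed edge of the Bruhat graph
except those of the form `x → s x`. All forms of the lifting property follow from this. -/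
theorem BruhatEdge.simple_mul {x y : W} (h : cs.BruhatEdge x y) {i : B}
    (hne : y ≠ cs.simple i * x) : cs.BruhatEdge (cs.simple i * x) (cs.simple i * y) := by
  obtain ⟨t, ht, rfl, hl⟩ := cs.bruhatEdge_iff_left.1 h
  have hti : t ≠ cs.simple i := by rintro rfl; exact hne rfl
  have := (cs.length_simple_mul_refl_mul_lt_iff (w := t * x) ht hti).2
    (by rwa [← mul_assoc, ht.mul_self, one_mul])
  rw [← mul_assoc t, ht.mul_self, one_mul] at this
  refine cs.bruhatEdge_iff_left.2 ⟨cs.simple i * t * (cs.simple i)⁻¹, ht.conj _, ?_, this⟩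
  simp [mul_assoc]

variable (cs) in
theorem bruhatEdge_simple_mul {x : W} {i : B} (h : ¬ cs.IsLeftDescent x i) :
    cs.BruhatEdge x (cs.simple i * x) :=
  cs.bruhatEdge_iff_left.2 ⟨_, cs.isReflection_simple i, rfl, by
    rw [cs.not_isLeftDescent_iff.1 h]; exact Nat.lt_succ_self _⟩

variable (cs) in
theorem simple_mul_bruhatEdge {x : W} {i : B} (h : cs.IsLeftDescent x i) :
    cs.BruhatEdge (cs.simple i * x) x :=
  cs.bruhatEdge_iff_left.2 ⟨_, cs.isReflection_simple i, by simp, h⟩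

variable (cs) in
theorem isLeftDescent_simple_mul_iff {x : W} {i : B} :
    cs.IsLeftDescent (cs.simple i * x) i ↔ ¬ cs.IsLeftDescent x i := by
  rw [cs.isLeftDescent_iff_not_isLeftDescent_mul, simple_mul_simple_cancel_left]

open Classical in
variable (cs) in
/-- The larger of `w` and `s w`, where `s` is the `i`-th simple reflection. -/
noncomputable def simpleMax (i : B) (w : W) : W :=
  if cs.IsLeftDescent w i then w else cs.simple i * w

open Classical in
variable (cs) in
/-- The smaller of `w` and `s w`, where `s` is the `i`-th simple reflection. -/
noncomputable def simpleMin (i : B) (w : W) : W :=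
  if cs.IsLeftDescent w i then cs.simple i * w else w

variable (cs) in
theorem le_simpleMax (i : B) (w : W) : cs.BruhatLE w (cs.simpleMax i w) := by
  unfold simpleMax
  split_ifs with h
  exacts [.refl, (cs.bruhatEdge_simple_mul h).le]

variable (cs) in
theorem simple_mul_le_simpleMax (i : B) (w : W) :
    cs.BruhatLE (cs.simple i * w) (cs.simpleMax i w) := by
  unfold simpleMax
  split_ifs with h
  exacts [(cs.simple_mul_bruhatEdge h).le, .refl]

variable (cs) in
theorem simpleMin_le (i : B) (w : W) : cs.BruhatLE (cs.simpleMin i w) w := by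
  unfold simpleMin
  split_ifs with h
  exacts [(cs.simple_mul_bruhatEdge h).le, .refl]

variable (cs) in
theorem simpleMin_le_simple_mul (i : B) (w : W) :
    cs.BruhatLE (cs.simpleMin i w) (cs.simple i * w) := by
  unfold simpleMin
  split_ifs with h
  exacts [.refl, (cs.bruhatEdge_simple_mul h).le]

variable (cs) in
theorem simpleMax_simple_mul (i : B) (w : W) :
    cs.simpleMax i (cs.simple i * w) = cs.simpleMax i w := by
  unfold simpleMax
  by_cases h : cs.IsLeftDescent w i <;> simp [isLeftDescent_simple_mul_iff, h]

variable (cs) in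
theorem simpleMin_simple_mul (i : B) (w : W) :
    cs.simpleMin i (cs.simple i * w) = cs.simpleMin i w := by
  unfold simpleMin
  by_cases h : cs.IsLeftDescent w i <;> simp [isLeftDescent_simple_mul_iff, h]

theorem BruhatLE.simpleMax {x y : W} (h : cs.BruhatLE x y) (i : B) :
    cs.BruhatLE (cs.simpleMax i x) (cs.simpleMax i y) := by
  induction h with
  | refl => exact .refl
  | @tail y z _ h ih =>
    refine ih.trans ?_
    by_cases hz : z = cs.simple i * y
    · rw [hz, simpleMax_simple_mul]; exact .refl
    · have h' := h.simple_mul hz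
      rw [CoxeterSystem.simpleMax]
      split_ifs
      exacts [h.le.trans (cs.le_simpleMax i z), h'.le.trans (cs.simple_mul_le_simpleMax i z)]

theorem BruhatLE.simpleMin {x y : W} (h : cs.BruhatLE x y) (i : B) :
    cs.BruhatLE (cs.simpleMin i x) (cs.simpleMin i y) := by
  induction h with
  | refl => exact .refl
  | @tail y z _ h ih =>
    refine ih.trans ?_
    by_cases hz : z = cs.simple i * y
    · rw [hz, simpleMin_simple_mul]; exact .refl
    · have h' := h.simple_mul hz
      rw [CoxeterSystem.simpleMin.eq_1 _ _ z]
      split_ifs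
      exacts [(cs.simpleMin_le_simple_mul i y).trans h'.le, (cs.simpleMin_le i y).trans h.le]

theorem BruhatLE.le_simple_mul {x y : W} (h : cs.BruhatLE x y) {i : B}
    (hx : ¬ cs.IsLeftDescent x i) (hy : cs.IsLeftDescent y i) :
    cs.BruhatLE x (cs.simple i * y) := by
  simpa [CoxeterSystem.simpleMin, hx, hy] using h.simpleMin i

theorem BruhatLE.simple_mul_le_simple_mul {x y : W} (h : cs.BruhatLE x y) {i : B}
    (hx : cs.IsLeftDescent x i) (hy : cs.IsLeftDescent y i) :
    cs.BruhatLE (cs.simple i * x) (cs.simple i * y) := by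
  simpa [CoxeterSystem.simpleMin, hx, hy] using h.simpleMin i

theorem BruhatLE.simple_mul_le {x y : W} (h : cs.BruhatLE x y) {i : B}
    (hy : cs.IsLeftDescent y i) : cs.BruhatLE (cs.simple i * x) y := by
  have := (cs.simple_mul_le_simpleMax i x).trans (h.simpleMax i)
  simpa [CoxeterSystem.simpleMax, hy] using this

variable (cs) in
/-- `y` covers `x` in the Bruhat order of the whole group, expressed through the length. -/
def BruhatCov (x y : W) : Prop :=
  cs.BruhatEdge x y ∧ cs.length y = cs.length x + 1

theorem BruhatCov.ne {x y : W} (h : cs.BruhatCov x y) : x ≠ y := h.1.ne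

theorem BruhatCov.le {x y : W} (h : cs.BruhatCov x y) : cs.BruhatLE x y := h.1.le

variable (cs) in
theorem bruhatCov_simple_mul {x : W} {i : B} (h : ¬ cs.IsLeftDescent x i) :
    cs.BruhatCov x (cs.simple i * x) :=
  ⟨cs.bruhatEdge_simple_mul h, cs.not_isLeftDescent_iff.1 h⟩

variable (cs) in
theorem simple_mul_bruhatCov {x : W} {i : B} (h : cs.IsLeftDescent x i) :
    cs.BruhatCov (cs.simple i * x) x :=
  ⟨cs.simple_mul_bruhatEdge h, (cs.isLeftDescent_iff.1 h).symm⟩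

/-- The lifting property for covers. -/
theorem BruhatCov.eq_simple_mul {x y : W} (h : cs.BruhatCov x y) {i : B}
    (hx : ¬ cs.IsLeftDescent x i) (hy : cs.IsLeftDescent y i) : y = cs.simple i * x := by
  by_contra hne
  have h1 := (h.1.simple_mul hne).length_lt
  have h2 := h.2
  rw [cs.not_isLeftDescent_iff] at hx
  rw [cs.isLeftDescent_iff] at hy
  omega

theorem BruhatCov.simple_mul {x y : W} (h : cs.BruhatCov x y) {i : B}
    (hxy : cs.IsLeftDescent x i ↔ cs.IsLeftDescent y i) :
    cs.BruhatCov (cs.simple i * x) (cs.simple i * y) := by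
  have hne : y ≠ cs.simple i * x := by
    rintro rfl
    rw [isLeftDescent_simple_mul_iff] at hxy
    tauto
  refine ⟨h.1.simple_mul hne, ?_⟩
  have h2 := h.2
  by_cases hx : cs.IsLeftDescent x i
  · have hy := hxy.1 hx
    rw [cs.isLeftDescent_iff] at hx hy
    omega
  · have hy := fun h => hx (hxy.2 h)
    rw [← Not, cs.not_isLeftDescent_iff] at hy
    rw [cs.not_isLeftDescent_iff] at hx
    omega

/-- The Bruhat order is graded by the length. -/
theorem BruhatLE.exists_cov {x y : W} (h : cs.BruhatLE x y) (hne : x ≠ y) :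
    ∃ m, cs.BruhatLE x m ∧ cs.BruhatCov m y := by
  induction hn : cs.length y generalizing x y with
  | zero =>
    have := (BruhatLE.eq_or_length_lt cs h).resolve_left hne
    omega
  | succ n ih =>
    obtain ⟨i, hi⟩ := cs.exists_leftDescent_of_ne_one (w := y) (by
      rintro rfl; simp at hn)
    have hl := cs.isLeftDescent_iff.1 hi
    by_cases hx : cs.IsLeftDescent x i
    · obtain ⟨m, hm, hmy⟩ := ih (h.simple_mul_le_simple_mul hx hi) (by simpa using hne) (by omega)
      by_cases hmi : cs.IsLeftDescent m i
      · refine ⟨cs.simple i * y, ?_, cs.simple_mul_bruhatCov hi⟩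
        have := hm.simple_mul_le hmi
        rw [simple_mul_simple_cancel_left] at this
        exact this.trans hmy.le
      · refine ⟨cs.simple i * m, ?_, ?_⟩
        · have := hm.trans (cs.bruhatEdge_simple_mul hmi).le
          have := this.simple_mul_le (cs.isLeftDescent_simple_mul_iff.2 hmi)
          rwa [simple_mul_simple_cancel_left] at this
        · have := hmy.simple_mul (i := i)
            (iff_of_false hmi (by simpa [isLeftDescent_simple_mul_iff] using hi))
          rwa [simple_mul_simple_cancel_left] at this
    · exact ⟨_, h.le_simple_mul hx hi, cs.simple_mul_bruhatCov hi⟩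

/-- Bruhat intervals of length two are thin: they have at most two elements besides their
endpoints. -/
theorem not_three_mid {x y a b c : W} (ha : cs.BruhatCov x a) (hb : cs.BruhatCov x b)
    (hc : cs.BruhatCov x c) (ha' : cs.BruhatCov a y) (hb' : cs.BruhatCov b y)
    (hc' : cs.BruhatCov c y) (hab : a ≠ b) (hac : a ≠ c) (hbc : b ≠ c) : False := by
  induction hn : cs.length y generalizing x y a b c with
  | zero => have := ha'.2; omega
  | succ n ih =>
    obtain ⟨i, hi⟩ := cs.exists_leftDescent_of_ne_one (w := y) (by
      rintro rfl; simp at hn)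
    have hl := cs.isLeftDescent_iff.1 hi
    by_cases hx : cs.IsLeftDescent x i
    · have aux : ∀ {a b c : W}, cs.BruhatCov x a → cs.BruhatCov x b →
          cs.BruhatCov x c → cs.BruhatCov a y → cs.BruhatCov b y →
          cs.BruhatCov c y → a ≠ b → a ≠ c → b ≠ c → ¬ cs.IsLeftDescent a i → False := by
        intro a b c ha hb hc ha' hb' hc' hab hac hbc hai
        obtain rfl := ha'.eq_simple_mul hai hi
        have hbi : cs.IsLeftDescent b i := by
          by_contra h
          exact hab (mul_left_cancel (hb'.eq_simple_mul h hi))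
        have hci : cs.IsLeftDescent c i := by
          by_contra h
          exact hac (mul_left_cancel (hc'.eq_simple_mul h hi))
        have e1 := hb'.simple_mul (iff_of_true hbi hi)
        have e2 := hc'.simple_mul (iff_of_true hci hi)
        rw [simple_mul_simple_cancel_left] at e1 e2 hl
        refine ih (cs.simple_mul_bruhatCov hx) (hb.simple_mul (iff_of_true hx hbi))
          (hc.simple_mul (iff_of_true hx hci)) ha e1 e2 ?_ ?_ (by simpa using hbc) (by omega)
        · rintro rfl; exact cs.isLeftDescent_simple_mul_iff.1 hx hbi
        · rintro rfl; exact cs.isLeftDescent_simple_mul_iff.1 hx hci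
      by_cases hai : cs.IsLeftDescent a i
      · by_cases hbi : cs.IsLeftDescent b i
        · by_cases hci : cs.IsLeftDescent c i
          · exact ih (ha.simple_mul (iff_of_true hx hai)) (hb.simple_mul (iff_of_true hx hbi))
              (hc.simple_mul (iff_of_true hx hci)) (ha'.simple_mul (iff_of_true hai hi))
              (hb'.simple_mul (iff_of_true hbi hi)) (hc'.simple_mul (iff_of_true hci hi))
              (by simpa using hab) (by simpa using hac) (by simpa using hbc) (by omega)
          · exact aux hc ha hb hc' ha' hb' hac.symm hbc.symm hab hci
        · exact aux hb ha hc hb' ha' hc' hab.symm hbc hac hbi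
      · exact aux ha hb hc ha' hb' hc' hab hac hbc hai
    · have aux : ∀ {a : W}, cs.BruhatCov x a → cs.BruhatCov a y →
          a = cs.simple i * x ∨ a = cs.simple i * y := by
        intro a ha ha'
        by_cases hai : cs.IsLeftDescent a i
        · exact Or.inl (ha.eq_simple_mul hx hai)
        · right; rw [ha'.eq_simple_mul hai hi]; simp
      have := aux ha ha'
      have := aux hb hb'
      have := aux hc hc'
      grind

variable (cs) in
/-- A butterfly: two distinct elements `x, x'` with two distinct common covers `y, y'` in the
Bruhat order. -/
structure IsButterfly (x x' y y' : W) : Prop where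
  ne_bot : x ≠ x'
  ne_top : y ≠ y'
  cov₁₁ : cs.BruhatCov x y
  cov₁₂ : cs.BruhatCov x y'
  cov₂₁ : cs.BruhatCov x' y
  cov₂₂ : cs.BruhatCov x' y'

theorem IsButterfly.swap_top {x x' y y' : W} (h : cs.IsButterfly x x' y y') :
    cs.IsButterfly x x' y' y :=
  ⟨h.ne_bot, h.ne_top.symm, h.cov₁₂, h.cov₁₁, h.cov₂₂, h.cov₂₁⟩

theorem IsButterfly.swap_bot {x x' y y' : W} (h : cs.IsButterfly x x' y y') :
    cs.IsButterfly x' x y y' :=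
  ⟨h.ne_bot.symm, h.ne_top, h.cov₂₁, h.cov₂₂, h.cov₁₁, h.cov₁₂⟩

/-! ### Right-angled Coxeter groups: pairs of descents -/

open Classical in
/-- In a right-angled Coxeter group each generator `a` has a sign character, which is `-1` on `a`
and `1` on all other generators. -/
theorem IsRightAngled.exists_character (h : cs.IsRightAngled) (a : B) :
    ∃ χ : W →* ℤˣ, ∀ i, χ (cs.simple i) = if i = a then -1 else 1 := by
  have hl : M.IsLiftable (fun i : B => if i = a then (-1 : ℤˣ) else 1) := by
    intro i j
    by_cases hij : i = j
    · subst hij; simp only [Int.units_mul_self, one_pow]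
    · rcases h i j hij with h | h <;> simp only [h, Int.units_sq, pow_zero]
  exact ⟨cs.lift ⟨_, hl⟩, fun i => cs.lift_apply_simple hl i⟩

theorem IsRightAngled.simple_injective (h : cs.IsRightAngled) :
    Function.Injective cs.simple := by
  intro i j hij
  obtain ⟨χ, hχ⟩ := h.exists_character i
  have h1 := hχ i
  rw [hij, hχ j] at h1
  by_contra hne
  rw [if_neg (Ne.symm hne)] at h1
  simp at h1

/-- The sign characters determine the generator to which a reflection is conjugate, and distinguish
`r t s` with three distinct generators from all reflections. -/
theorem IsRightAngled.not_bruhatEdge (h : cs.IsRightAngled) {i j k : B} (hij : i ≠ j)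
    (hik : i ≠ k) (hjk : j ≠ k) (w : W) :
    ¬ cs.BruhatEdge (cs.simple i * w) (cs.simple j * (cs.simple k * w)) := by
  intro he
  obtain ⟨t, ⟨g, a, rfl⟩, he, -⟩ := cs.bruhatEdge_iff_left.1 he
  rw [← mul_assoc, ← mul_assoc] at he
  have he := mul_right_cancel he
  have key : ∀ χ : W →* ℤˣ, χ (cs.simple j) * χ (cs.simple k) =
      χ (cs.simple a) * χ (cs.simple i) := by
    intro χ
    rw [← map_mul, he]
    simp only [map_mul, map_inv]
    rw [mul_comm (χ g), mul_assoc (χ _) (χ g), mul_inv_cancel, mul_one]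
  obtain ⟨χ, hχ⟩ := h.exists_character i
  obtain ⟨χ', hχ'⟩ := h.exists_character j
  have h1 := key χ
  have h2 := key χ'
  simp only [hχ, hχ', if_neg hij.symm, if_neg hik.symm, if_neg hjk.symm, if_neg hij, if_true]
    at h1 h2
  by_cases ha : a = i
  · subst ha; simp [hij] at h2
  · simp [ha] at h1

theorem IsRightAngled.pow_ne_one (h : cs.IsRightAngled) {i j : B} (hij : i ≠ j)
    (hM : M i j = 0) (n : ℕ) : (cs.simple i * cs.simple j) ^ (n + 1) ≠ 1 := by
  classical
  have hM' : M j i = 0 := by rw [M.symmetric]; exact hM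
  let f : B → DihedralGroup 0 := fun k =>
    if k = i then .sr 0 else if k = j then .sr 1 else 1
  have hl : M.IsLiftable f := by
    intro k l
    by_cases hkl : k = l
    · subst hkl
      rw [M.diagonal, pow_one]
      by_cases h1 : k = i
      · simp [f, h1]
      · by_cases h2 : k = j <;> simp [f, h1, h2, hij.symm]
    · rcases h k l hkl with h | h
      · have hsq : ∀ k, f k ^ 2 = 1 := by
          intro k
          by_cases h1 : k = i
          · simp [f, h1, pow_two]
          · by_cases h2 : k = j <;> simp [f, h1, h2, hij.symm, pow_two]
        have : f k = 1 ∨ f l = 1 := by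
          by_contra hc
          push Not at hc
          have hk : k = i ∨ k = j := by
            by_contra hk; push Not at hk; exact hc.1 (by simp [f, hk])
          have hl : l = i ∨ l = j := by
            by_contra hk; push Not at hk; exact hc.2 (by simp [f, hk])
          rcases hk with rfl | rfl <;> rcases hl with rfl | rfl <;> simp_all
        rw [h]
        rcases this with h | h <;> simp [h, hsq]
      · simp [h]
  intro hc
  have h1 := congrArg (cs.lift ⟨f, hl⟩) hc
  rw [map_pow, map_mul, map_one, lift_apply_simple, lift_apply_simple] at h1
  simp only [f, if_true, if_neg hij.symm, DihedralGroup.sr_mul_sr, sub_zero,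
    DihedralGroup.r_one_pow, DihedralGroup.one_def, DihedralGroup.r.injEq] at h1
  have h2 : ((n + 1 : ℕ) : ℤ) = 0 := h1
  omega

/-- Two alternating chains descending from the same element never end if the generators have a
product of infinite order. -/
theorem false_of_alternating {i j : B} (hord : ∀ n, (cs.simple i * cs.simple j) ^ (n + 1) ≠ 1)
    {a b : W} {n : ℕ} (hb : b = (cs.simple i * cs.simple j) ^ n * a)
    (h₁ : cs.BruhatEdge (cs.simple i * a) b) (h₂ : cs.BruhatEdge (cs.simple j * b) a) : False := by
  induction hN : cs.length a + cs.length b using Nat.strong_induction_on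
    generalizing i j a b n with
  | _ N ih =>
  have hinv : cs.simple j * cs.simple i = (cs.simple i * cs.simple j)⁻¹ := by simp
  have hne : b ≠ cs.simple j * (cs.simple i * a) := by
    rw [hb, ← mul_assoc, hinv]
    intro h
    apply hord n
    rw [pow_succ, mul_right_cancel h, inv_mul_cancel]
  have hne' : a ≠ cs.simple i * (cs.simple j * b) := by
    intro h
    apply hne
    rw [h]; simp
  refine ih _ ?_ (i := j) (j := i) ?_ (n := n + 1) ?_ (h₁.simple_mul hne) (h₂.simple_mul hne') rfl
  · have := h₁.length_lt
    have := h₂.length_lt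
    omega
  · intro n h
    apply hord n
    rw [hinv, inv_pow] at h
    simpa using h
  · have e : ∀ n : ℕ, cs.simple j * (cs.simple i * cs.simple j) ^ n =
        (cs.simple j * cs.simple i) ^ n * cs.simple j := by
      intro n
      induction n with
      | zero => simp
      | succ n ih =>
        calc cs.simple j * (cs.simple i * cs.simple j) ^ (n + 1)
            = cs.simple j * cs.simple i * (cs.simple j * (cs.simple i * cs.simple j) ^ n) := by
              rw [pow_succ']; simp only [mul_assoc]
          _ = (cs.simple j * cs.simple i) ^ (n + 1) * cs.simple j := by
              rw [ih, pow_succ']; simp only [mul_assoc]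
    rw [hb, ← mul_assoc, e, pow_succ]
    simp [mul_assoc]

theorem IsRightAngled.commute_of_isLeftDescent (h : cs.IsRightAngled) {i j : B} (hij : i ≠ j)
    {x : W} (hi : cs.IsLeftDescent x i) (hj : cs.IsLeftDescent x j) : M i j = 2 := by
  refine (h i j hij).resolve_right fun hM => ?_
  exact false_of_alternating (h.pow_ne_one hij hM) (n := 0) (a := x) (b := x) (by simp)
    (cs.simple_mul_bruhatEdge hi) (cs.simple_mul_bruhatEdge hj)

theorem simple_mul_comm {i j : B} (hM : M i j = 2) :
    cs.simple i * cs.simple j = cs.simple j * cs.simple i := by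
  have h := cs.simple_mul_simple_pow i j
  rw [hM, pow_two] at h
  rw [eq_inv_of_mul_eq_one_left h]; simp

theorem simple_mul_left_comm {i j : B} (hM : M i j = 2) (w : W) :
    cs.simple i * (cs.simple j * w) = cs.simple j * (cs.simple i * w) := by
  rw [← mul_assoc, simple_mul_comm hM, mul_assoc]

theorem IsRightAngled.isLeftDescent_simple_mul_iff_of_ne (h : cs.IsRightAngled) {i j : B}
    (hij : i ≠ j) (hM : M i j = 2) {x : W} :
    cs.IsLeftDescent (cs.simple i * x) j ↔ cs.IsLeftDescent x j := by
  have key : ∀ x : W, cs.IsLeftDescent x j → cs.IsLeftDescent (cs.simple i * x) j := by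
    intro x hx
    have := (cs.simple_mul_bruhatEdge hx).simple_mul (i := i) (by
      intro h'
      rw [← mul_assoc] at h'
      have h' := right_eq_mul.1 h'
      exact hij (h.simple_injective (by simpa using mul_eq_one_iff_eq_inv.1 h')))
    rw [simple_mul_left_comm hM] at this
    exact this.length_lt
  refine ⟨fun hx => ?_, key x⟩
  simpa using key _ hx

/-! ### Right-angled Coxeter groups: butterflies -/

/-- In a right-angled Coxeter group, a simple reflection `s` that is not a left descent of `w` is a
left descent of at most one element covered by `w`: the one obtained by deleting the only letter
of `w` that keeps `s` from moving to the front. -/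
theorem IsRightAngled.cov_unique (h : cs.IsRightAngled) {x x' w : W} {i : B}
    (hx : cs.BruhatCov x w) (hx' : cs.BruhatCov x' w) (hi : cs.IsLeftDescent x i)
    (hi' : cs.IsLeftDescent x' i) (hw : ¬ cs.IsLeftDescent w i) : x = x' := by
  induction hn : cs.length w generalizing x x' w with
  | zero => have := hx.2; omega
  | succ n ih =>
    obtain ⟨r, hr⟩ := cs.exists_leftDescent_of_ne_one (w := w) (by rintro rfl; simp at hn)
    have hl := cs.isLeftDescent_iff.1 hr
    have hri : r ≠ i := by rintro rfl; exact hw hr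
    rcases h r i hri with hM | hM
    · have hd : ∀ {x}, cs.BruhatCov x w → cs.IsLeftDescent x i → cs.IsLeftDescent x r := by
        intro x hx hi
        by_contra hxr
        rw [hx.eq_simple_mul hxr hr, h.isLeftDescent_simple_mul_iff_of_ne hri hM] at hw
        exact hw hi
      have h1 := hd hx hi
      have h2 := hd hx' hi'
      have := ih (hx.simple_mul (iff_of_true h1 hr)) (hx'.simple_mul (iff_of_true h2 hr))
        ((h.isLeftDescent_simple_mul_iff_of_ne hri hM).2 hi)
        ((h.isLeftDescent_simple_mul_iff_of_ne hri hM).2 hi')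
        (fun h' => hw ((h.isLeftDescent_simple_mul_iff_of_ne hri hM).1 h')) (by omega)
      exact mul_left_cancel this
    · have hd : ∀ {x}, cs.BruhatCov x w → cs.IsLeftDescent x i → w = cs.simple r * x := by
        intro x hx hi
        refine hx.eq_simple_mul (fun hxr => ?_) hr
        have := h.commute_of_isLeftDescent hri hxr hi
        omega
      exact mul_left_cancel ((hd hx hi).symm.trans (hd hx' hi'))

/-- In a right-angled Coxeter group, let `s, t` be commuting simple reflections with `s w, t w > w`.
The only common cover of `s w` and `t w` is `s t w`; here it is excluded because it has left
descents `s, t`. -/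
theorem IsRightAngled.not_cov_of_commute (h : cs.IsRightAngled) {i j : B} (hij : i ≠ j)
    (hM : M i j = 2) {w x : W} (hwi : ¬ cs.IsLeftDescent w i) (hwj : ¬ cs.IsLeftDescent w j)
    (hxi : ¬ cs.IsLeftDescent x i) (hxj : ¬ cs.IsLeftDescent x j)
    (hi : cs.BruhatCov (cs.simple i * w) x) (hj : cs.BruhatCov (cs.simple j * w) x) : False := by
  induction hn : cs.length x generalizing w x with
  | zero => have := hi.2; omega
  | succ n ih =>
    obtain ⟨r, hr⟩ := cs.exists_leftDescent_of_ne_one (w := x) (by rintro rfl; simp at hn)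
    have hl := cs.isLeftDescent_iff.1 hr
    have hri : r ≠ i := by rintro rfl; exact hxi hr
    have hrj : r ≠ j := by rintro rfl; exact hxj hr
    have hM' : M j i = 2 := by rw [M.symmetric]; exact hM
    have h1 : cs.IsLeftDescent (cs.simple i * w) r := by
      by_contra h1
      have e := hi.eq_simple_mul h1 hr
      rw [e] at hj
      exact h.not_bruhatEdge hrj.symm hij.symm hri w hj.1
    have h2 : cs.IsLeftDescent (cs.simple j * w) r := by
      by_contra h2
      have e := hj.eq_simple_mul h2 hr
      rw [e] at hi
      exact h.not_bruhatEdge hri.symm hij hrj w hi.1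
    have hji : ¬ cs.IsLeftDescent (cs.simple j * w) i := by
      rwa [h.isLeftDescent_simple_mul_iff_of_ne hij.symm hM']
    have hij' : ¬ cs.IsLeftDescent (cs.simple i * w) j := by
      rwa [h.isLeftDescent_simple_mul_iff_of_ne hij hM]
    have c1 := cs.bruhatCov_simple_mul hji
    have c2 := cs.bruhatCov_simple_mul hij'
    rw [simple_mul_left_comm hM'] at c2
    have h3 : cs.IsLeftDescent (cs.simple i * (cs.simple j * w)) r := by
      by_contra h3
      have := h.cov_unique c1 c2 h2 h1 h3
      exact hij (h.simple_injective (mul_right_cancel this)).symm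
    have h4 : cs.IsLeftDescent (cs.simple i * (cs.simple j * w)) i :=
      cs.isLeftDescent_simple_mul_iff.2 hji
    have h5 : cs.IsLeftDescent (cs.simple i * (cs.simple j * w)) j := by
      rw [simple_mul_left_comm hM]
      exact cs.isLeftDescent_simple_mul_iff.2 hij'
    have hMi := h.commute_of_isLeftDescent hri h3 h4
    have hMj := h.commute_of_isLeftDescent hrj h3 h5
    have d1 := hi.simple_mul (iff_of_true h1 hr)
    have d2 := hj.simple_mul (iff_of_true h2 hr)
    rw [simple_mul_left_comm hMi] at d1
    rw [simple_mul_left_comm hMj] at d2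
    refine ih (w := cs.simple r * w) (x := cs.simple r * x) ?_ ?_ ?_ ?_ d1 d2 (by omega)
    all_goals first
      | rwa [h.isLeftDescent_simple_mul_iff_of_ne hri hMi]
      | rwa [h.isLeftDescent_simple_mul_iff_of_ne hrj hMj]

/-- In a right-angled Coxeter group, the covers `s x` and `t x` of `x` by left multiplication with
two simple reflections are not part of a butterfly. -/
theorem IsRightAngled.not_isButterfly_simple_mul (h : cs.IsRightAngled) {i j : B} {x x' : W}
    (hb : cs.IsButterfly x x' (cs.simple i * x) (cs.simple j * x)) : False := by
  have hij : i ≠ j := by rintro rfl; exact hb.ne_top rfl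
  have hi : ¬ cs.IsLeftDescent x i := cs.not_isLeftDescent_iff.2 hb.cov₁₁.2
  have hj : ¬ cs.IsLeftDescent x j := cs.not_isLeftDescent_iff.2 hb.cov₁₂.2
  have hi1 := cs.isLeftDescent_simple_mul_iff.2 hi
  have hj1 := cs.isLeftDescent_simple_mul_iff.2 hj
  have hi' : cs.IsLeftDescent x' i := by
    by_contra hc
    exact hb.ne_bot (mul_left_cancel (hb.cov₂₁.eq_simple_mul hc hi1))
  have hj' : cs.IsLeftDescent x' j := by
    by_contra hc
    exact hb.ne_bot (mul_left_cancel (hb.cov₂₂.eq_simple_mul hc hj1))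
  have hM := h.commute_of_isLeftDescent hij hi' hj'
  have hM' : M j i = 2 := by rw [M.symmetric]; exact hM
  have c1 := hb.cov₂₁.simple_mul (iff_of_true hi' hi1)
  have c2 := hb.cov₂₂.simple_mul (iff_of_true hj' hj1)
  rw [simple_mul_simple_cancel_left] at c1 c2
  refine h.not_cov_of_commute hij hM (w := cs.simple i * (cs.simple j * x')) ?_ ?_ hi hj ?_ ?_
  · rw [cs.isLeftDescent_simple_mul_iff, not_not, h.isLeftDescent_simple_mul_iff_of_ne hij.symm hM']
    exact hi'
  · rw [simple_mul_left_comm hM, cs.isLeftDescent_simple_mul_iff, not_not,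
      h.isLeftDescent_simple_mul_iff_of_ne hij hM]
    exact hj'
  · rwa [simple_mul_simple_cancel_left]
  · rwa [simple_mul_left_comm hM, simple_mul_simple_cancel_left]

/-- In a right-angled Coxeter group, two distinct elements have at most two common covers. -/
theorem IsRightAngled.not_three_covers (h : cs.IsRightAngled) {x x' a b c : W} (hne : x ≠ x')
    (hab : a ≠ b) (hac : a ≠ c) (hbc : b ≠ c) (ha : cs.BruhatCov x a) (hb : cs.BruhatCov x b)
    (hc : cs.BruhatCov x c) (ha' : cs.BruhatCov x' a) (hb' : cs.BruhatCov x' b)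
    (hc' : cs.BruhatCov x' c) : False := by
  induction hn : cs.length x generalizing x x' a b c with
  | zero =>
    have h0 := ha.2
    have h1 := ha'.2
    have e1 := cs.length_eq_zero_iff.1 hn
    have e2 := cs.length_eq_zero_iff.1 (show cs.length x' = 0 by omega)
    exact hne (e1.trans e2.symm)
  | succ n ih =>
    by_cases hD : ∃ i, cs.IsLeftDescent x i ∧ cs.IsLeftDescent x' i
    · obtain ⟨i, hi, hi'⟩ := hD
      have hd : ∀ {y}, cs.BruhatCov x y → cs.BruhatCov x' y → cs.IsLeftDescent y i := by
        intro y h1 h2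
        by_contra h3
        exact hne (h.cov_unique h1 h2 hi hi' h3)
      have da := hd ha ha'
      have db := hd hb hb'
      have dc := hd hc hc'
      have hl := cs.isLeftDescent_iff.1 hi
      exact ih (by simpa using hne) (by simpa using hab) (by simpa using hac) (by simpa using hbc)
        (ha.simple_mul (iff_of_true hi da)) (hb.simple_mul (iff_of_true hi db))
        (hc.simple_mul (iff_of_true hi dc)) (ha'.simple_mul (iff_of_true hi' da))
        (hb'.simple_mul (iff_of_true hi' db)) (hc'.simple_mul (iff_of_true hi' dc)) (by omega)
    · -- Each common cover is a simple multiple of `x` or of `x'`; two of the three agree in this.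
      have key : ∀ {y}, cs.BruhatCov x y → cs.BruhatCov x' y →
          (∃ i, y = cs.simple i * x) ∨ ∃ i, y = cs.simple i * x' := by
        intro y h1 h2
        obtain ⟨i, hi⟩ := cs.exists_leftDescent_of_ne_one (w := y) (by
          rintro rfl; have := h1.2; simp at this)
        by_cases hx : cs.IsLeftDescent x i
        · exact Or.inr ⟨i, h2.eq_simple_mul (fun h' => hD ⟨i, hx, h'⟩) hi⟩
        · exact Or.inl ⟨i, h1.eq_simple_mul hx hi⟩
      have two : ∀ {x x' y y'}, cs.IsButterfly x x' y y' → (∃ i, y = cs.simple i * x) →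
          (∃ i, y' = cs.simple i * x) → False := by
        rintro x x' y y' hB ⟨i, rfl⟩ ⟨j, rfl⟩
        exact h.not_isButterfly_simple_mul hB
      have Bab : cs.IsButterfly x x' a b := ⟨hne, hab, ha, hb, ha', hb'⟩
      have Bac : cs.IsButterfly x x' a c := ⟨hne, hac, ha, hc, ha', hc'⟩
      have Bbc : cs.IsButterfly x x' b c := ⟨hne, hbc, hb, hc, hb', hc'⟩
      rcases key ha ha' with h1 | h1 <;> rcases key hb hb' with h2 | h2
      · exact two Bab h1 h2
      · rcases key hc hc' with h3 | h3
        · exact two Bac h1 h3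
        · exact two Bbc.swap_bot h2 h3
      · rcases key hc hc' with h3 | h3
        · exact two Bbc h2 h3
        · exact two Bac.swap_bot h1 h3
      · exact two Bab.swap_bot h1 h2

/-- If `s` is not a left descent of the top element `y'` of a butterfly, then there is a bottom
element `z` of which it is not a left descent either. When `s` is a left descent of the other top
element `y`, the lifting property shows that `y = s z`. -/
theorem IsRightAngled.exists_bot (h : cs.IsRightAngled) {x x' y y' : W}
    (hb : cs.IsButterfly x x' y y') {i : B} (hy' : ¬ cs.IsLeftDescent y' i) :
    ∃ z, (z = x ∨ z = x') ∧ ¬ cs.IsLeftDescent z i ∧ cs.BruhatCov z y ∧ cs.BruhatCov z y' := by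
  by_cases hx : cs.IsLeftDescent x i
  · refine ⟨x', Or.inr rfl, fun hx' => ?_, hb.cov₂₁, hb.cov₂₂⟩
    exact hb.ne_bot (h.cov_unique hb.cov₁₂ hb.cov₂₂ hx hx' hy')
  · exact ⟨x, Or.inl rfl, hx, hb.cov₁₁, hb.cov₁₂⟩

theorem IsButterfly.isLeftDescent_bot {x x' y y' : W} (hb : cs.IsButterfly x x' y y') {i : B}
    (hy : cs.IsLeftDescent y i) (hy' : cs.IsLeftDescent y' i) :
    cs.IsLeftDescent x i ∧ cs.IsLeftDescent x' i := by
  constructor <;> by_contra hc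
  · exact hb.ne_top ((hb.cov₁₁.eq_simple_mul hc hy).trans (hb.cov₁₂.eq_simple_mul hc hy').symm)
  · exact hb.ne_top ((hb.cov₂₁.eq_simple_mul hc hy).trans (hb.cov₂₂.eq_simple_mul hc hy').symm)

theorem IsButterfly.simple_mul {x x' y y' : W} (hb : cs.IsButterfly x x' y y') {i : B}
    (hy : cs.IsLeftDescent y i) (hy' : cs.IsLeftDescent y' i) :
    cs.IsButterfly (cs.simple i * x) (cs.simple i * x') (cs.simple i * y) (cs.simple i * y') := by
  obtain ⟨hx, hx'⟩ := hb.isLeftDescent_bot hy hy'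
  exact ⟨by simpa using hb.ne_bot, by simpa using hb.ne_top,
    hb.cov₁₁.simple_mul (iff_of_true hx hy), hb.cov₁₂.simple_mul (iff_of_true hx hy'),
    hb.cov₂₁.simple_mul (iff_of_true hx' hy), hb.cov₂₂.simple_mul (iff_of_true hx' hy')⟩

/-- In a right-angled Coxeter group, any upper bound `v` of the top of a butterfly is above a common
cover of its two top elements. -/
theorem IsRightAngled.exists_common_cover (h : cs.IsRightAngled) {x x' y y' v : W}
    (hb : cs.IsButterfly x x' y y') (hy : cs.BruhatLE y v) (hy' : cs.BruhatLE y' v) :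
    ∃ q, cs.BruhatLE q v ∧ cs.BruhatCov y q ∧ cs.BruhatCov y' q := by
  induction hn : cs.length v generalizing x x' y y' v with
  | zero => have := hy.length_le; have := hb.cov₁₁.2; omega
  | succ n ih =>
    obtain ⟨i, hi⟩ := cs.exists_leftDescent_of_ne_one (w := v) (by rintro rfl; simp at hn)
    have hl := cs.isLeftDescent_iff.1 hi
    have mixed : ∀ {y y'}, cs.IsButterfly x x' y y' → cs.BruhatLE y' v → cs.IsLeftDescent y i →
        ¬ cs.IsLeftDescent y' i → ∃ q, cs.BruhatLE q v ∧ cs.BruhatCov y q ∧ cs.BruhatCov y' q := by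
      intro y y' hb hy' hyi hyi'
      obtain ⟨z, -, hz, hzy, hzy'⟩ := h.exists_bot hb hyi'
      refine ⟨cs.simple i * y', hy'.simple_mul_le hi, ?_, cs.bruhatCov_simple_mul hyi'⟩
      rw [hzy.eq_simple_mul hz hyi]
      exact hzy'.simple_mul (iff_of_false hz hyi')
    by_cases hyi : cs.IsLeftDescent y i <;> by_cases hyi' : cs.IsLeftDescent y' i
    · obtain ⟨q, hqv, hq, hq'⟩ := ih (hb.simple_mul hyi hyi') (hy.simple_mul_le_simple_mul hyi hi)
        (hy'.simple_mul_le_simple_mul hyi' hi) (by omega)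
      have hyn := fun h => cs.isLeftDescent_simple_mul_iff.1 h hyi
      have hyn' := fun h => cs.isLeftDescent_simple_mul_iff.1 h hyi'
      have hqi : ¬ cs.IsLeftDescent q i := by
        intro hc
        have e := (hq.eq_simple_mul hyn hc).symm.trans (hq'.eq_simple_mul hyn' hc)
        simp only [simple_mul_simple_cancel_left] at e
        exact hb.ne_top e
      have c1 := hq.simple_mul (iff_of_false hyn hqi)
      have c2 := hq'.simple_mul (iff_of_false hyn' hqi)
      rw [simple_mul_simple_cancel_left] at c1 c2
      exact ⟨_, (hqv.trans (cs.simple_mul_bruhatEdge hi).le).simple_mul_le hi, c1, c2⟩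
    · exact mixed hb hy' hyi hyi'
    · obtain ⟨q, h1, h2, h3⟩ := mixed hb.swap_top hy hyi' hyi
      exact ⟨q, h1, h3, h2⟩
    · obtain ⟨q, hqv, hq⟩ := ih hb (hy.le_simple_mul hyi hi) (hy'.le_simple_mul hyi' hi) (by omega)
      exact ⟨q, hqv.trans (cs.simple_mul_bruhatEdge hi).le, hq⟩

/-- In a right-angled Coxeter group, let `q` be a common cover of the top of a butterfly, and let
`r` cover `q` and be joined by reflections to the two bottom elements. Then `r` covers another
common cover of the top. -/
theorem IsRightAngled.exists_other_common_cover (h : cs.IsRightAngled) {x x' y y' q r : W}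
    (hb : cs.IsButterfly x x' y y') (hq : cs.BruhatCov y q) (hq' : cs.BruhatCov y' q)
    (hr : cs.BruhatCov q r) (hxr : cs.BruhatEdge x r) (hxr' : cs.BruhatEdge x' r) :
    ∃ p, p ≠ q ∧ cs.BruhatCov y p ∧ cs.BruhatCov y' p ∧ cs.BruhatCov p r := by
  induction hn : cs.length r generalizing x x' y y' q r with
  | zero => have := hr.2; omega
  | succ n ih =>
    obtain ⟨i, hi⟩ := cs.exists_leftDescent_of_ne_one (w := r) (by rintro rfl; simp at hn)
    have hl := cs.isLeftDescent_iff.1 hi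
    have hedge : ∀ {z y}, cs.BruhatCov z y → cs.BruhatCov y q → cs.BruhatEdge z r →
        cs.BruhatEdge (cs.simple i * z) (cs.simple i * r) := by
      intro z y h1 h2 h3
      refine h3.simple_mul ?_
      intro hc
      have := congrArg cs.length hc
      have := h1.2
      have := h2.2
      have := hr.2
      rcases cs.length_simple_mul z i with h | h <;> omega
    have mixed : ∀ {y y'}, cs.IsButterfly x x' y y' → cs.BruhatCov y q → cs.BruhatCov y' q →
        cs.IsLeftDescent y i → ¬ cs.IsLeftDescent y' i →
        ∃ p, p ≠ q ∧ cs.BruhatCov y p ∧ cs.BruhatCov y' p ∧ cs.BruhatCov p r := by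
      intro y y' hb hq hq' hyi hyi'
      obtain ⟨z, hzx, hz, hzy, hzy'⟩ := h.exists_bot hb hyi'
      have hzr : cs.BruhatEdge z r := by rcases hzx with rfl | rfl <;> assumption
      have e := hzy.eq_simple_mul hz hyi
      by_cases hqi : cs.IsLeftDescent q i
      · refine ⟨cs.simple i * r, ?_, ?_, ?_, cs.simple_mul_bruhatCov hi⟩
        · rintro rfl; exact cs.isLeftDescent_simple_mul_iff.1 hqi hi
        · refine ⟨e ▸ hedge hzy hq hzr, ?_⟩
          have := hq.2
          have := hr.2
          omega
        · have := hr.simple_mul (iff_of_true hqi hi)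
          rwa [hq'.eq_simple_mul hyi' hqi, simple_mul_simple_cancel_left] at this
      · refine ⟨cs.simple i * y', ?_, ?_, cs.bruhatCov_simple_mul hyi', ?_⟩
        · rintro rfl; exact hqi (cs.isLeftDescent_simple_mul_iff.2 hyi')
        · rw [e]; exact hzy'.simple_mul (iff_of_false hz hyi')
        · rw [hr.eq_simple_mul hqi hi]; exact hq'.simple_mul (iff_of_false hyi' hqi)
    by_cases hyi : cs.IsLeftDescent y i <;> by_cases hyi' : cs.IsLeftDescent y' i
    · have hqi : cs.IsLeftDescent q i := by
        by_contra hc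
        exact hb.ne_top (h.cov_unique hq hq' hyi hyi' hc)
      obtain ⟨p, hpq, hp, hp', hpr⟩ := ih (hb.simple_mul hyi hyi')
        (hq.simple_mul (iff_of_true hyi hqi)) (hq'.simple_mul (iff_of_true hyi' hqi))
        (hr.simple_mul (iff_of_true hqi hi)) (hedge hb.cov₁₁ hq hxr) (hedge hb.cov₂₁ hq hxr')
        (by omega)
      have hyn := fun h => cs.isLeftDescent_simple_mul_iff.1 h hyi
      have hyn' := fun h => cs.isLeftDescent_simple_mul_iff.1 h hyi'
      have hpi : ¬ cs.IsLeftDescent p i := by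
        intro hc
        have e := (hp.eq_simple_mul hyn hc).symm.trans (hp'.eq_simple_mul hyn' hc)
        simp only [simple_mul_simple_cancel_left] at e
        exact hb.ne_top e
      have c1 := hp.simple_mul (iff_of_false hyn hpi)
      have c2 := hp'.simple_mul (iff_of_false hyn' hpi)
      have c3 := hpr.simple_mul (i := i)
        (iff_of_false hpi fun h => cs.isLeftDescent_simple_mul_iff.1 h hi)
      rw [simple_mul_simple_cancel_left] at c1 c2 c3
      refine ⟨_, ?_, c1, c2, c3⟩
      rintro rfl
      simp at hpq
    · exact mixed hb hq hq' hyi hyi'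
    · obtain ⟨p, h0, h1, h2, h3⟩ := mixed hb.swap_top hq' hq hyi' hyi
      exact ⟨p, h0, h2, h1, h3⟩
    · -- This case is impossible: `s z` would be a third element between `z` and `q`.
      exfalso
      have hqi : ¬ cs.IsLeftDescent q i := fun hc =>
        hb.ne_top (mul_left_cancel
          ((hq.eq_simple_mul hyi hc).symm.trans (hq'.eq_simple_mul hyi' hc)))
      obtain ⟨z, hzx, hz, hzy, hzy'⟩ := h.exists_bot hb hyi'
      have hzr : cs.BruhatEdge z r := by rcases hzx with rfl | rfl <;> assumption
      have hsz := cs.isLeftDescent_simple_mul_iff.2 hz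
      have e := hedge hzy hq hzr
      rw [hr.eq_simple_mul hqi hi, simple_mul_simple_cancel_left] at e
      have c := cs.bruhatCov_simple_mul hz
      refine not_three_mid c hzy hzy' ⟨e, ?_⟩ hq hq' ?_ ?_ hb.ne_top
      · have := hq.2
        have := hzy.2
        have := c.2
        omega
      · rintro e; exact hyi (e ▸ hsz)
      · rintro e; exact hyi' (e ▸ hsz)

/-! ### Matchings of Bruhat intervals -/

theorem bruhatCov_of_covBy {u v : W} {a b : cs.BruhatInterval u v} (h : a ⋖ b) :
    cs.BruhatCov a.1 b.1 := by
  obtain ⟨m, ham, hmb⟩ := BruhatLE.exists_cov (cs := cs) (x := a.1) (y := b.1) h.lt.le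
    (fun e => h.lt.ne (Subtype.ext e))
  let m' : cs.BruhatInterval u v := ⟨m, a.2.1.trans ham, hmb.le.trans b.2.2⟩
  by_cases e : a.1 = m
  · rw [e]; exact hmb
  · have h1 : a ≤ m' := ham
    have h2 : m' ≤ b := hmb.le
    exact absurd (lt_of_le_of_ne h2 fun e' => hmb.ne (congrArg Subtype.val e'))
      (h.2 (lt_of_le_of_ne h1 fun e' => e (congrArg Subtype.val e')))

theorem bruhatIntervalGraph_adj {u v : W} {a b : cs.BruhatInterval u v} :
    (cs.bruhatIntervalGraph u v).Adj a b ↔ cs.BruhatEdge a.1 b.1 ∨ cs.BruhatEdge b.1 a.1 := by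
  simp only [bruhatIntervalGraph, bruhatGraph]
  refine ⟨fun h => h.2, fun h => ⟨?_, h⟩⟩
  rcases h with h | h
  exacts [h.ne, h.ne.symm]

variable (cs) in
/-- A perfect matching of the Hasse diagram of `[u, v]` that preserves the adjacency of the
undirected Bruhat graph, expressed through edges and covers of the whole group. -/
structure IsBruhatMatching {u v : W} (f : cs.BruhatInterval u v → cs.BruhatInterval u v) :
    Prop where
  involutive : Function.Involutive f
  cov : ∀ a, cs.BruhatCov a.1 (f a).1 ∨ cs.BruhatCov (f a).1 a.1
  edge : ∀ a b, cs.BruhatEdge a.1 b.1 →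
    cs.BruhatEdge (f a).1 (f b).1 ∨ cs.BruhatEdge (f b).1 (f a).1

theorem IsBruhatMatching.of_automorphism {u v : W}
    {f : cs.BruhatInterval u v → cs.BruhatInterval u v}
    (hf : IsPerfectMatchingMap (SimpleGraph.hasse (cs.BruhatInterval u v)) f)
    (hauto : ∃ φ : cs.bruhatIntervalGraph u v ≃g cs.bruhatIntervalGraph u v, ⇑φ = f) :
    cs.IsBruhatMatching f where
  involutive := hf.involutive
  cov a := by
    have := hf.adj a
    rw [SimpleGraph.hasse_adj] at this
    exact this.imp bruhatCov_of_covBy bruhatCov_of_covBy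
  edge a b h := by
    obtain ⟨φ, rfl⟩ := hauto
    exact bruhatIntervalGraph_adj.1 (φ.map_adj_iff.2 (bruhatIntervalGraph_adj.2 (Or.inl h)))

/-- A matching automorphism fails to be special only if it matches the bottom of some butterfly
with its top. -/
theorem isSpecialMatching_of_not_isButterfly {u v : W}
    {f : cs.BruhatInterval u v → cs.BruhatInterval u v}
    (hf : IsPerfectMatchingMap (SimpleGraph.hasse (cs.BruhatInterval u v)) f)
    (hm : cs.IsBruhatMatching f)
    (h : ∀ a b, ¬ cs.IsButterfly a.1 b.1 (f b).1 (f a).1) : IsSpecialMatching f := by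
  refine ⟨hf, fun x y hxy => ?_⟩
  by_contra! hc
  obtain ⟨hne, hlt⟩ := hc
  have c := bruhatCov_of_covBy hxy
  have hyx : cs.BruhatEdge (f y).1 (f x).1 := by
    refine (hm.edge x y c.1).resolve_left fun he => hlt ?_
    exact lt_of_le_of_ne (show cs.BruhatLE _ _ from he.le)
      (fun e => he.ne (congrArg Subtype.val e))
  have hl := hyx.length_lt
  have hl' := c.2
  -- Comparing lengths, the matching goes up from `x` and down from `y`.
  have cx : cs.BruhatCov x.1 (f x).1 := by
    refine (hm.cov x).resolve_right fun c' => ?_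
    have := c'.2
    rcases hm.cov y with c'' | c'' <;> have := c''.2 <;> omega
  have cy : cs.BruhatCov (f y).1 y.1 := by
    refine (hm.cov y).resolve_left fun c' => ?_
    have := c'.2
    have := cx.2
    omega
  refine h x (f y) ⟨?_, ?_, ?_, cx, ?_, hyx, ?_⟩
  · intro e
    apply hne
    rw [Subtype.ext e, hm.involutive]
  · rw [hm.involutive]
    exact fun e => hne (Subtype.ext e).symm
  · rwa [hm.involutive]
  · rwa [hm.involutive]
  · have := cx.2
    have := cy.2
    omega

theorem IsBruhatMatching.edge_of_length_lt {u v : W}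
    {f : cs.BruhatInterval u v → cs.BruhatInterval u v} (hm : cs.IsBruhatMatching f)
    {a b : cs.BruhatInterval u v} (h : cs.BruhatEdge a.1 b.1 ∨ cs.BruhatEdge b.1 a.1)
    (hl : cs.length (f a).1 < cs.length (f b).1) : cs.BruhatEdge (f a).1 (f b).1 := by
  rcases h with h | h
  · exact (hm.edge a b h).resolve_right fun h' => hl.asymm h'.length_lt
  · exact (hm.edge b a h).resolve_left fun h' => hl.asymm h'.length_lt

/-- In a right-angled Coxeter group, a matching automorphism never matches the bottom of a butterfly
with its top: the common covers of the top would form the bottom of another such butterfly, so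
there would be an infinite ascent in the interval. -/
theorem IsRightAngled.not_isButterfly (hW : cs.IsRightAngled) {u v : W}
    {f : cs.BruhatInterval u v → cs.BruhatInterval u v} (hm : cs.IsBruhatMatching f)
    (a b : cs.BruhatInterval u v) : ¬ cs.IsButterfly a.1 b.1 (f b).1 (f a).1 := by
  intro hb
  induction hn : cs.length v - cs.length a.1 using Nat.strong_induction_on
    generalizing a b with
  | _ n ih =>
  have la := hb.cov₁₂.2
  have lb := hb.cov₂₁.2
  have lab := hb.cov₁₁.2
  -- The image of a common cover of the top lies above it.
  have key : ∀ q : cs.BruhatInterval u v, cs.BruhatCov (f b).1 q.1 → cs.BruhatCov (f a).1 q.1 →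
      cs.BruhatCov q.1 (f q).1 ∧ cs.BruhatEdge a.1 (f q).1 ∧ cs.BruhatEdge b.1 (f q).1 := by
    intro q hqb hqa
    have lq := hqb.2
    have hl : cs.length a.1 < cs.length (f q).1 := by
      rcases hm.cov q with c | c <;> have := c.2 <;> omega
    have ea := hm.edge_of_length_lt (a := f a) (b := q) (Or.inl hqa.1)
      (by rwa [hm.involutive])
    have eb := hm.edge_of_length_lt (a := f b) (b := q) (Or.inl hqb.1)
      (by rw [hm.involutive]; omega)
    rw [hm.involutive] at ea eb
    refine ⟨(hm.cov q).resolve_right fun c => ?_, ea, eb⟩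
    have lc := c.2
    have hne : ∀ z : cs.BruhatInterval u v, cs.length z.1 < cs.length q.1 →
        (f z).1 ≠ (f q).1 := by
      intro z hz e
      rw [hm.involutive.injective (Subtype.ext e)] at hz
      exact lt_irrefl _ hz
    exact hW.not_three_covers hb.ne_bot hb.ne_top (hne b (by omega)) (hne a (by omega))
      hb.cov₁₁ hb.cov₁₂ ⟨ea, by omega⟩ hb.cov₂₁ hb.cov₂₂ ⟨eb, by omega⟩
  obtain ⟨q, hqv, hqb, hqa⟩ := hW.exists_common_cover hb (f b).2.2 (f a).2.2
  let q' : cs.BruhatInterval u v := ⟨q, (f b).2.1.trans hqb.le, hqv⟩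
  obtain ⟨cq, eqa, eqb⟩ := key q' hqb hqa
  obtain ⟨p, hpq, hpb, hpa, hpr⟩ := hW.exists_other_common_cover hb hqb hqa cq eqa eqb
  let p' : cs.BruhatInterval u v := ⟨p, (f b).2.1.trans hpb.le, hpr.le.trans (f q').2.2⟩
  obtain ⟨cp, -, -⟩ := key p' hpb hpa
  have lq := hqb.2
  have lp := hpb.2
  have lcp := cp.2
  have e : cs.BruhatEdge q (f p').1 := by
    have := hm.edge_of_length_lt (a := f q') (b := p') (Or.inr hpr.1)
      (by rw [hm.involutive]; change cs.length q < _; change _ = cs.length p + 1 at lcp; omega)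
    rwa [hm.involutive] at this
  have lv := hqv.length_le
  refine ih (cs.length v - cs.length q) (by omega) q' p' ⟨hpq.symm, ?_, ⟨e, ?_⟩, cq, cp, hpr⟩ rfl
  · intro e
    exact hpq (congrArg Subtype.val (hm.involutive.injective (Subtype.ext e)))
  · change _ = cs.length p + 1 at lcp
    change _ = cs.length q + 1
    omega

end CoxeterSystem

/-! ### Products of two transpositions -/

section Swap

open Equiv

variable {α : Type*} [DecidableEq α]

theorem Equiv.Perm.IsSwap.eq_swap_of_apply_eq {t : Perm α} (ht : t.IsSwap) {a b : α}
    (h : t a = b) (hab : a ≠ b) : t = swap a b := by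
  obtain ⟨c, d, hcd, rfl⟩ := ht
  rw [swap_apply_def] at h
  split_ifs at h with h1 h2
  · subst h1 h; rfl
  · subst h2 h; exact swap_comm _ _
  · exact absurd h hab

/-- If a transposition divides a nontrivial product of two transpositions, then it only moves
points that the product moves. -/
theorem Equiv.Perm.apply_ne_of_swap_mul {g t : Perm α} {a b : α} (hab : a ≠ b)
    (ht : t.IsSwap) (hg : g = swap a b * t) (hg1 : g ≠ 1) : g a ≠ a := by
  intro h
  have : t a = b := by
    have := congrArg (swap a b) h
    rw [hg] at this
    simpa using this
  rw [ht.eq_swap_of_apply_eq this hab] at hg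
  exact hg1 (by simp [hg])

theorem swap_mul_swap_cycle {a b c : α} (hab : a ≠ b) (hac : a ≠ c) (hbc : b ≠ c) :
    swap a b * swap b c = swap b c * swap c a ∧ swap a b * swap b c = swap c a * swap a b := by
  constructor <;> ext x <;> simp only [Perm.mul_apply, swap_apply_def] <;> grind

/-- A three-cycle is a product of two transpositions in exactly three ways. -/
theorem eq_of_swap_mul_swap_eq_cycle {a b c : α} (hab : a ≠ b) (hac : a ≠ c) (hbc : b ≠ c)
    {t t' : Perm α} (ht : t.IsSwap) (ht' : t'.IsSwap) (h : swap a b * swap b c = t * t') :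
    (t = swap a b ∧ t' = swap b c) ∨ (t = swap b c ∧ t' = swap c a) ∨
      (t = swap c a ∧ t' = swap a b) := by
  obtain ⟨e₁, e₂⟩ := swap_mul_swap_cycle hab hac hbc
  obtain ⟨e, f, hef, rfl⟩ := ht
  have hg1 : swap a b * swap b c ≠ 1 := by
    intro h
    have := congrArg (fun g : Perm α => g a) h
    simp [swap_apply_of_ne_of_ne hab hac] at this
    exact hab this.symm
  have mem : ∀ x, (swap a b * swap b c) x ≠ x → x = a ∨ x = b ∨ x = c := by
    intro x hx
    by_contra! hc
    apply hx
    simp [swap_apply_of_ne_of_ne, hc]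
  have he := mem e (Perm.apply_ne_of_swap_mul hef ht' h hg1)
  have hf := mem f (Perm.apply_ne_of_swap_mul hef.symm ht' (by rw [swap_comm f e]; exact h) hg1)
  have h3 : swap e f = swap a b ∨ swap e f = swap b c ∨ swap e f = swap c a := by
    rcases he with rfl | rfl | rfl <;> rcases hf with rfl | rfl | rfl <;>
      simp_all [swap_comm]
  rcases h3 with h3 | h3 | h3 <;> rw [h3] at h ⊢
  · exact Or.inl ⟨rfl, (mul_left_cancel h).symm⟩
  · exact Or.inr (Or.inl ⟨rfl, (mul_left_cancel (e₁.symm.trans h)).symm⟩)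
  · exact Or.inr (Or.inr ⟨rfl, (mul_left_cancel (e₂.symm.trans h)).symm⟩)

/-- A product of two disjoint transpositions has no other factorizations than the obvious ones. -/
theorem eq_of_swap_mul_swap_eq_disjoint {a b c d : α} (hab : a ≠ b) (hcd : c ≠ d) (hac : a ≠ c)
    (had : a ≠ d) (hbc : b ≠ c) (hbd : b ≠ d)
    {t t' : Perm α} (ht : t.IsSwap) (ht' : t'.IsSwap) (h : swap a b * swap c d = t * t') :
    t = swap a b ∨ t = swap c d := by
  obtain ⟨e, f, hef, rfl⟩ := ht
  have hg1 : swap a b * swap c d ≠ 1 := by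
    intro h
    have := congrArg (fun g : Perm α => g a) h
    simp [swap_apply_of_ne_of_ne hac had] at this
    exact hab this.symm
  have mem : ∀ x, (swap a b * swap c d) x ≠ x → x = a ∨ x = b ∨ x = c ∨ x = d := by
    intro x hx
    by_contra! hc
    apply hx
    simp [swap_apply_of_ne_of_ne, hc]
  have he := mem e (Perm.apply_ne_of_swap_mul hef ht' h hg1)
  have hf := mem f (Perm.apply_ne_of_swap_mul hef.symm ht' (by rw [swap_comm f e]; exact h) hg1)
  -- The second factor `t'` is an involution, which fails when `e` and `f` lie in different cycles.
  have hinv : ∀ x, t' (t' x) = x := by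
    obtain ⟨k, l, -, rfl⟩ := ht'
    simp
  have ht'' : ∀ x, t' x = swap e f (swap a b (swap c d x)) := by
    intro x
    have := congrArg (fun g : Perm α => swap e f (g x)) h
    simpa using this.symm
  have ha := hinv a
  have hc := hinv c
  simp only [ht'', swap_apply_def] at ha hc
  rcases he with rfl | rfl | rfl | rfl <;> rcases hf with rfl | rfl | rfl | rfl <;>
    first
      | exact Or.inl rfl
      | exact Or.inr rfl
      | exact Or.inl (swap_comm _ _)
      | exact Or.inr (swap_comm _ _)
      | grind

end Swap

namespace CoxeterSystem

open Equiv

variable {B : Type*} {W : Type*} [Group W] {M : CoxeterMatrix B} {cs : CoxeterSystem M W}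

/-! ### The Bruhat order of the symmetric group -/

variable (cs) in
/-- An isomorphism of `W` with a symmetric group that identifies the simple reflections with the
adjacent transpositions. -/
def IsStandardIso {n : ℕ} (φ : W ≃* Perm (Fin n)) : Prop :=
  φ '' Set.range cs.simple =
    {σ | ∃ (i : ℕ) (h : i + 1 < n), σ = swap ⟨i, i.lt_succ_self.trans h⟩ ⟨i + 1, h⟩}

variable {n : ℕ} {φ : W ≃* Perm (Fin n)}

theorem IsStandardIso.map_simple (hφ : cs.IsStandardIso φ) (i : B) :
    ∃ k l : Fin n, (l : ℕ) = k + 1 ∧ φ (cs.simple i) = swap k l := by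
  have : φ (cs.simple i) ∈ φ '' Set.range cs.simple := ⟨_, ⟨i, rfl⟩, rfl⟩
  rw [hφ] at this
  obtain ⟨k, hk, h⟩ := this
  exact ⟨_, _, rfl, h⟩

theorem IsStandardIso.isReflection_iff (hφ : cs.IsStandardIso φ) {t : W} :
    cs.IsReflection t ↔ (φ t).IsSwap := by
  constructor
  · rintro ⟨w, i, rfl⟩
    obtain ⟨k, l, hkl, h⟩ := hφ.map_simple i
    refine ⟨φ w k, φ w l, ?_, ?_⟩
    · intro e
      have := (φ w).injective e
      subst this
      omega
    · rw [map_mul, map_mul, h, map_inv, mul_swap_eq_swap_mul, mul_inv_cancel_right]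
  · rintro ⟨a, b, hab, h⟩
    have hn : 0 + 1 < n := by
      by_contra hn
      apply hab
      ext
      omega
    have hmem : swap (⟨0, by omega⟩ : Fin n) ⟨0 + 1, hn⟩ ∈ φ '' Set.range cs.simple := by
      rw [hφ]; exact ⟨0, hn, rfl⟩
    obtain ⟨_, ⟨i, rfl⟩, hi⟩ := hmem
    have h01 : (⟨0, by omega⟩ : Fin n) ≠ ⟨0 + 1, hn⟩ := by simp
    obtain ⟨g, hg⟩ := isConj_iff.1 (Perm.isConj_swap h01 hab)
    refine ⟨φ.symm g, i, φ.injective ?_⟩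
    rw [map_mul, map_mul, map_inv, hi, h, ← hg, MulEquiv.apply_symm_apply]

/-- In the symmetric group, left multiplication by a transposition of values shortens a permutation
exactly when it removes the corresponding inversion. -/
theorem IsStandardIso.length_swap_mul_lt_iff (hφ : cs.IsStandardIso φ) (w : W) {a b : Fin n}
    (hab : a ≠ b) : cs.length (φ.symm (swap a b) * w) < cs.length w ↔
      ¬ (a < b ↔ (φ w)⁻¹ a < (φ w)⁻¹ b) := by
  induction w using cs.simple_induction_left generalizing a b with
  | one => simp
  | mul_simple_left w i ih =>
    obtain ⟨k, l, hkl, hs⟩ := hφ.map_simple i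
    have e : ∀ x, (φ (cs.simple i * w))⁻¹ x = (φ w)⁻¹ (swap k l x) := by
      intro x; rw [map_mul, hs, mul_inv_rev, swap_inv, Perm.mul_apply]
    have ht : cs.IsReflection (φ.symm (swap a b)) :=
      hφ.isReflection_iff.2 ⟨a, b, hab, by simp⟩
    rw [e, e]
    by_cases hti : φ.symm (swap a b) = cs.simple i
    · have hsw : swap a b = swap k l := by rw [← hs, ← hti, MulEquiv.apply_symm_apply]
      have h := ih hab
      rw [hti] at h ⊢
      rw [simple_mul_simple_cancel_left, ← hsw, swap_apply_left, swap_apply_right]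
      have := cs.length_simple_mul_ne w i
      have hne : (φ w)⁻¹ a ≠ (φ w)⁻¹ b := fun h => hab ((φ w)⁻¹.injective h)
      have h1 : cs.length w < cs.length (cs.simple i * w) ↔
        ¬ cs.length (cs.simple i * w) < cs.length w := by omega
      rw [h1, h]
      have h2 : (φ w)⁻¹ b < (φ w)⁻¹ a ↔ ¬ (φ w)⁻¹ a < (φ w)⁻¹ b := by
        rw [not_lt]; exact ⟨le_of_lt, fun h => lt_of_le_of_ne h hne.symm⟩
      rw [h2]
      tauto
    · have ht' : cs.IsReflection (cs.simple i * φ.symm (swap a b) * (cs.simple i)⁻¹) := ht.conj _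
      have hti' : cs.simple i * φ.symm (swap a b) * (cs.simple i)⁻¹ ≠ cs.simple i := by
        intro h
        apply hti
        rw [mul_inv_eq_iff_eq_mul, mul_right_inj] at h
        exact h
      have h := cs.length_simple_mul_refl_mul_lt_iff (w := w) ht' hti'
      have e1 : cs.simple i * (cs.simple i * φ.symm (swap a b) * (cs.simple i)⁻¹ * w) =
          φ.symm (swap a b) * (cs.simple i * w) := by simp [mul_assoc]
      have e2 : cs.simple i * φ.symm (swap a b) * (cs.simple i)⁻¹ =
          φ.symm (swap (swap k l a) (swap k l b)) := by
        apply φ.injective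
        rw [map_mul, map_mul, map_inv, hs, MulEquiv.apply_symm_apply, MulEquiv.apply_symm_apply,
          mul_swap_eq_swap_mul, mul_inv_cancel_right]
      rw [e1, e2, ih (by simpa using hab)] at h
      rw [h]
      have hsw : swap a b ≠ swap k l := by
        intro h; apply hti; rw [h, ← hs, MulEquiv.symm_apply_apply]
      -- An adjacent transposition preserves the order of every other pair of values.
      have hlt : swap k l a < swap k l b ↔ a < b := by
        have h1 : ¬ (a = k ∧ b = l) := by rintro ⟨rfl, rfl⟩; exact hsw rfl
        have h2 : ¬ (a = l ∧ b = k) := by rintro ⟨rfl, rfl⟩; exact hsw (swap_comm _ _)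
        simp only [swap_apply_def]
        split_ifs <;> omega
      rw [hlt]

/-- The Bruhat edges of the symmetric group, by exchanging the values at two positions. -/
theorem IsStandardIso.bruhatEdge_iff (hφ : cs.IsStandardIso φ) {x y : W} {a b : Fin n}
    (hab : a ≠ b) (h : φ y = φ x * swap a b) :
    cs.BruhatEdge x y ↔ (a < b ↔ φ x a < φ x b) := by
  have hab' : φ x a ≠ φ x b := by simpa using hab
  have hy : y = φ.symm (swap (φ x a) (φ x b)) * x := by
    apply φ.injective
    rw [h, map_mul, MulEquiv.apply_symm_apply, mul_swap_eq_swap_mul]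
  have ht : cs.IsReflection (φ.symm (swap (φ x a) (φ x b))) :=
    hφ.isReflection_iff.2 ⟨_, _, hab', by simp⟩
  have hne := ht.length_mul_right_ne x
  have hl := hφ.length_swap_mul_lt_iff x hab'
  rw [← hy] at hne hl
  rw [show (φ x)⁻¹ (φ x a) = a from (φ x).symm_apply_apply a,
    show (φ x)⁻¹ (φ x b) = b from (φ x).symm_apply_apply b] at hl
  rw [iff_comm (a := a < b), ← not_iff_not, ← hl]
  constructor
  · intro h'
    by_contra hc
    exact h' (cs.bruhatEdge_iff_left.2 ⟨_, ht, hy, by omega⟩)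
  · intro h' he
    exact h'.asymm he.length_lt

theorem IsStandardIso.exists_swap (hφ : cs.IsStandardIso φ) {x y : W} (h : cs.BruhatEdge x y) :
    ∃ a b, a ≠ b ∧ φ y = φ x * swap a b := by
  obtain ⟨t, ht, rfl, -⟩ := h
  obtain ⟨a, b, hab, h⟩ := hφ.isReflection_iff.1 ht
  exact ⟨a, b, hab, by rw [map_mul, h]⟩

/-- The permutations that stabilize an initial segment of values form a lower set. -/
theorem IsStandardIso.apply_lt_of_le (hφ : cs.IsStandardIso φ) {u w : W} (h : cs.BruhatLE u w)
    {a : ℕ} (hw : ∀ c : Fin n, (c : ℕ) < a → (φ w c : ℕ) < a) (c : Fin n) (hc : (c : ℕ) < a) :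
    (φ u c : ℕ) < a := by
  induction h using Relation.ReflTransGen.head_induction_on generalizing c with
  | refl => exact hw c hc
  | @head u w' he _ ih =>
    obtain ⟨i, j, hij, h⟩ := hφ.exists_swap he
    have hlt := (hφ.bruhatEdge_iff hij h).1 he
    have e : ∀ z, φ w' z = φ u (swap i j z) := fun z => by rw [h, Perm.mul_apply]
    have hne : φ u i ≠ φ u j := by simpa using hij
    by_cases hci : c = i
    · subst hci
      by_cases hj : (j : ℕ) < a
      · have := ih j hj
        rwa [e, swap_apply_right] at this
      · have := ih c hc
        rw [e, swap_apply_left] at this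
        omega
    · by_cases hcj : c = j
      · subst hcj
        by_cases hi : (i : ℕ) < a
        · have := ih i hi
          rwa [e, swap_apply_left] at this
        · have := ih c hc
          rw [e, swap_apply_right] at this
          omega
      · have := ih c hc
        rwa [e, swap_apply_of_ne_of_ne hci hcj] at this

/-- For `i < j < k`, the permutation `p` is above every common lower bound of the permutations
obtained from it by exchanging the values at the positions `i, j`, respectively at `j, k`. For
`p = 1` these transpositions have disjoint supports, and the general case follows by the lifting
property. -/
theorem IsStandardIso.le_of_le_swap (hφ : cs.IsStandardIso φ) {i j k : Fin n} (hij : i < j)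
    (hjk : j < k) {u p : W} (h₁ : cs.BruhatLE u (p * φ.symm (swap i j)))
    (h₂ : cs.BruhatLE u (p * φ.symm (swap j k))) : cs.BruhatLE u p := by
  induction hn : cs.length p generalizing u p with
  | zero =>
    have hp := cs.length_eq_zero_iff.1 hn
    subst hp
    rw [one_mul] at h₁ h₂
    have hseg : ∀ (a : ℕ) (c : Fin n), (c : ℕ) < a → (φ u c : ℕ) < a := by
      intro a
      by_cases ha : a ≤ j
      · refine hφ.apply_lt_of_le h₂ fun c hc => ?_
        rw [MulEquiv.apply_symm_apply, swap_apply_of_ne_of_ne (by omega) (by omega)]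
        exact hc
      · refine hφ.apply_lt_of_le h₁ fun c hc => ?_
        rw [MulEquiv.apply_symm_apply, swap_apply_def]
        split_ifs <;> omega
    have hfix : ∀ (m : ℕ) (c : Fin n), (c : ℕ) = m → φ u c = c := by
      intro m
      induction m using Nat.strong_induction_on with
      | _ m ih =>
        intro c hc
        by_contra hne
        have h := hseg (c + 1) c (Nat.lt_succ_self _)
        have hlt : (φ u c : ℕ) < m := by
          have : (φ u c : ℕ) ≠ c := fun h => hne (Fin.ext h)
          omega
        exact hne ((φ u).injective (ih _ hlt _ rfl))
    have hu : u = 1 := by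
      apply φ.injective
      rw [map_one]
      ext c
      rw [hfix _ c rfl, Perm.one_apply]
    rw [hu]
    exact .refl
  | succ m ih =>
    obtain ⟨s, hs⟩ := cs.exists_leftDescent_of_ne_one (w := p) (by rintro rfl; simp at hn)
    have hl := cs.isLeftDescent_iff.1 hs
    have key : ∀ t, cs.BruhatLE u (p * t) →
        cs.BruhatLE (cs.simpleMin s u) (cs.simple s * p * t) := by
      intro t h
      rw [mul_assoc]
      exact (h.simpleMin s).trans (cs.simpleMin_le_simple_mul s _)
    have h := ih (key _ h₁) (key _ h₂) (by omega)
    have h' := h.simpleMax s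
    rw [simpleMax_simple_mul] at h'
    have e1 : cs.simpleMax s p = p := by simp [simpleMax, hs]
    have e2 : cs.simpleMax s (cs.simpleMin s u) = cs.simpleMax s u := by
      unfold simpleMin
      split_ifs
      exacts [cs.simpleMax_simple_mul s u, rfl]
    rw [e1, e2] at h'
    exact (cs.le_simpleMax s u).trans h'

/-! ### Butterflies in the symmetric group -/

/-- The permutations `σ, σ'` and `τ, τ'` arise from a permutation `p` that is increasing on three
positions `i < j < k` by one, respectively two, of the exchanges of the positions `i, j` and
`j, k`. -/
def IsHexagonMiddle (p σ σ' τ τ' : Perm (Fin n)) (i j k : Fin n) : Prop :=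
  i < j ∧ j < k ∧ p i < p j ∧ p j < p k ∧
    ((σ = p * swap i j ∧ σ' = p * swap j k) ∨ (σ = p * swap j k ∧ σ' = p * swap i j)) ∧
    ((τ = p * swap i j * swap j k ∧ τ' = p * swap j k * swap i j) ∨
      (τ = p * swap j k * swap i j ∧ τ' = p * swap i j * swap j k))

theorem IsHexagonMiddle.swap_top {p σ σ' τ τ' : Perm (Fin n)} {i j k : Fin n}
    (h : IsHexagonMiddle p σ σ' τ τ' i j k) : IsHexagonMiddle p σ σ' τ' τ i j k :=
  ⟨h.1, h.2.1, h.2.2.1, h.2.2.2.1, h.2.2.2.2.1, h.2.2.2.2.2.symm.imp And.symm And.symm⟩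

/-- The four elements of a butterfly in the symmetric group are the four intermediate permutations
of three values placed at three positions. -/
theorem IsStandardIso.exists_isHexagonMiddle (hφ : cs.IsStandardIso φ) {x x' y y' : W}
    (hb : cs.IsButterfly x x' y y') :
    ∃ p i j k, IsHexagonMiddle p (φ x) (φ x') (φ y) (φ y') i j k := by
  -- The case of a given cyclic labelling of the three positions.
  have core : ∀ {y y' : W}, cs.IsButterfly x x' y y' → ∀ a b c : Fin n, a ≠ b → a ≠ c → b ≠ c →
      φ y = φ x * swap a b → φ y = φ x' * swap b c → φ y' = φ x * swap b c →
      φ y' = φ x' * swap c a →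
      ∃ p i j k, IsHexagonMiddle p (φ x) (φ x') (φ y) (φ y') i j k := by
    intro y y' hb a b c hab hac hbc e11 e21 e12 e22
    have hx' : φ x' = φ x * swap a b * swap b c := by rw [← e11, e21, mul_swap_mul_self]
    have u11 := (hφ.bruhatEdge_iff hab e11).1 hb.cov₁₁.1
    have u12 := (hφ.bruhatEdge_iff hbc e12).1 hb.cov₁₂.1
    have u21 := (hφ.bruhatEdge_iff hbc e21).1 hb.cov₂₁.1
    have u22 := (hφ.bruhatEdge_iff hac.symm e22).1 hb.cov₂₂.1
    have va : φ x' a = φ x b := by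
      rw [hx']; simp [swap_apply_of_ne_of_ne hab hac]
    have vb : φ x' b = φ x c := by
      rw [hx']; simp [swap_apply_of_ne_of_ne hac.symm hbc.symm]
    have vc : φ x' c = φ x a := by
      rw [hx']; simp
    rw [vb, vc] at u21
    rw [vc, va] at u22
    have n1 : φ x a ≠ φ x b := by simpa using hab
    have n2 : φ x a ≠ φ x c := by simpa using hac
    have n3 : φ x b ≠ φ x c := by simpa using hbc
    obtain ⟨c1, c2⟩ := swap_mul_swap_cycle hab hac hbc
    have x1 : φ x = φ x * swap c a * swap c a := by simp
    have x1' : φ x' = φ x * swap c a * swap a b := by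
      rw [hx', mul_assoc, mul_assoc, c2]
    have y1 : φ y = φ x * swap c a * swap c a * swap a b := by rw [e11]; simp
    have y1' : φ y' = φ x * swap c a * swap a b * swap c a := by
      rw [e22, x1']
    have pa : (φ x * swap c a) a = φ x c := by simp
    have pc : (φ x * swap c a) c = φ x a := by simp
    have pb : (φ x * swap c a) b = φ x b := by
      simp [swap_apply_of_ne_of_ne hbc hab.symm]
    rcases lt_or_gt_of_ne hac.symm with hca | hca
    · refine ⟨φ x * swap c a, c, a, b, hca, by omega, ?_, ?_, Or.inl ⟨x1, x1'⟩, Or.inl ⟨y1, y1'⟩⟩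
      · rw [pa, pc]; omega
      · rw [pa, pb]; omega
    · rw [swap_comm a b] at x1' y1 y1'
      rw [swap_comm c a] at x1 x1' y1 y1' pa pb pc
      refine ⟨φ x * swap a c, b, a, c, by omega, hca, ?_, ?_, Or.inr ⟨x1, x1'⟩, Or.inr ⟨y1, y1'⟩⟩
      · rw [pa, pb]; omega
      · rw [pa, pc]; omega
  obtain ⟨a, b, hab, e11⟩ := hφ.exists_swap hb.cov₁₁.1
  obtain ⟨c, d, hcd, e21⟩ := hφ.exists_swap hb.cov₂₁.1
  obtain ⟨e, f, hef, e12⟩ := hφ.exists_swap hb.cov₁₂.1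
  obtain ⟨g, h, hgh, e22⟩ := hφ.exists_swap hb.cov₂₂.1
  have hprod : swap a b * swap c d = swap e f * swap g h := by
    have h1 : φ x' = φ x * swap a b * swap c d := by rw [← e11, e21, mul_swap_mul_self]
    have h2 : φ x' = φ x * swap e f * swap g h := by rw [← e12, e22, mul_swap_mul_self]
    rw [h1, mul_assoc, mul_assoc] at h2
    exact mul_left_cancel h2
  have hne1 : swap a b ≠ swap c d := by
    intro hc
    rw [e11, hc] at e21
    exact hb.ne_bot (φ.injective (mul_right_cancel e21))
  have hne2 : swap e f ≠ swap a b := by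
    intro hc
    rw [hc, ← e11] at e12
    exact hb.ne_top (φ.injective e12).symm
  -- The case where the first two transpositions share the point `b`.
  have cyc : ∀ a b c : Fin n, a ≠ b → b ≠ c → φ y = φ x * swap a b → φ y = φ x' * swap b c →
      swap a b * swap b c = swap e f * swap g h → swap a b ≠ swap b c → swap e f ≠ swap a b →
      ∃ p i j k, IsHexagonMiddle p (φ x) (φ x') (φ y) (φ y') i j k := by
    intro a b c hab hbc e11 e21 hprod hne1 hne2
    have hac : a ≠ c := by rintro rfl; exact hne1 (swap_comm _ _)
    rcases eq_of_swap_mul_swap_eq_cycle hab hac hbc ⟨e, f, hef, rfl⟩ ⟨g, h, hgh, rfl⟩ hprod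
      with ⟨h1, -⟩ | ⟨h1, h2⟩ | ⟨h1, h2⟩
    · exact absurd h1 hne2
    · rw [h1] at e12
      rw [h2] at e22
      exact core hb a b c hab hac hbc e11 e21 e12 e22
    · rw [h1] at e12
      rw [h2] at e22
      obtain ⟨p, i, j, k, hp⟩ :=
        core hb.swap_top c a b hac.symm hbc.symm hab e12 e22 e11 e21
      exact ⟨p, i, j, k, hp.swap_top⟩
  by_cases hbc : b = c
  · subst hbc; exact cyc a b d hab hcd e11 e21 hprod hne1 hne2
  by_cases hbd : b = d
  · subst hbd
    rw [swap_comm c b] at e21 hprod hne1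
    exact cyc a b c hab hcd.symm e11 e21 hprod hne1 hne2
  by_cases hac : a = c
  · subst hac
    rw [swap_comm a b] at e11 hprod hne1 hne2
    exact cyc b a d hab.symm hcd e11 e21 hprod hne1 hne2
  by_cases had : a = d
  · subst had
    rw [swap_comm a b] at e11 hprod hne1 hne2
    rw [swap_comm c a] at e21 hprod hne1
    exact cyc b a c hab.symm hcd.symm e11 e21 hprod hne1 hne2
  -- Disjoint transpositions commute, and then `x' → y` cannot be an edge if `x → y'` is one.
  exfalso
  have h3 := (eq_of_swap_mul_swap_eq_disjoint hab hcd hac had hbc hbd ⟨e, f, hef, rfl⟩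
    ⟨g, h, hgh, rfl⟩ hprod).resolve_left hne2
  rw [h3] at e12
  have u1 := (hφ.bruhatEdge_iff hcd e12).1 hb.cov₁₂.1
  have u2 := (hφ.bruhatEdge_iff hcd e21).1 hb.cov₂₁.1
  have hx' : φ x' = φ x * swap a b * swap c d := by rw [← e11, e21, mul_swap_mul_self]
  have vc : φ x' c = φ x d := by
    rw [hx']; simp [swap_apply_of_ne_of_ne (Ne.symm had) (Ne.symm hbd)]
  have vd : φ x' d = φ x c := by
    rw [hx']; simp [swap_apply_of_ne_of_ne (Ne.symm hac) (Ne.symm hbc)]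
  rw [vc, vd] at u2
  have : φ x c ≠ φ x d := by simpa using hcd
  omega

/-- In the symmetric group, a matching automorphism never matches the bottom of a butterfly with
its top. The permutation `p` below the butterfly lies in the interval, and its image is adjacent
to the whole top of the butterfly. This leaves only the bottom of the butterfly and the
permutation `q` above it, neither of which can be matched with `p`. -/
theorem IsStandardIso.not_isButterfly (hφ : cs.IsStandardIso φ) {u v : W}
    {f : cs.BruhatInterval u v → cs.BruhatInterval u v} (hm : cs.IsBruhatMatching f)
    (a b : cs.BruhatInterval u v) : ¬ cs.IsButterfly a.1 b.1 (f b).1 (f a).1 := by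
  intro hb
  obtain ⟨p, i, j, k, hij, hjk, hp, hp', hx, hy⟩ := hφ.exists_isHexagonMiddle hb
  wlog hx' : φ a.1 = p * swap i j ∧ φ b.1 = p * swap j k generalizing a b
  · exact this b a hb.swap_bot.swap_top (hx.symm.imp And.symm And.symm)
      (hy.symm.imp And.symm And.symm) (hx.resolve_left hx').symm
  obtain ⟨ha, hb'⟩ := hx'
  have la := hb.cov₁₂.2
  have la' := hb.cov₁₁.2
  have lb' := hb.cov₂₁.2
  obtain ⟨P, rfl⟩ : ∃ P, φ P = p := φ.surjective p
  have ePa : cs.BruhatEdge P a.1 :=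
    (hφ.bruhatEdge_iff hij.ne ha).2 (iff_of_true hij hp)
  have ePb : cs.BruhatEdge P b.1 :=
    (hφ.bruhatEdge_iff hjk.ne hb').2 (iff_of_true hjk hp')
  have hPa : a.1 = P * φ.symm (swap i j) := φ.injective (by simp [ha])
  have hPb : b.1 = P * φ.symm (swap j k) := φ.injective (by simp [hb'])
  have huP : cs.BruhatLE u P :=
    hφ.le_of_le_swap hij hjk (hPa ▸ a.2.1) (hPb ▸ b.2.1)
  let P' : cs.BruhatInterval u v := ⟨P, huP, ePa.le.trans a.2.2⟩
  have lP := ePa.length_lt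
  have lm : cs.length (f P').1 ≤ cs.length P + 1 := by
    rcases hm.cov P' with c | c
    · exact c.2.le
    · have := c.2
      change cs.length P = _ at this
      omega
  have hadj : ∀ z : cs.BruhatInterval u v, cs.BruhatEdge P z.1 →
      ∃ t : Perm (Fin n), t.IsSwap ∧ φ (f P').1 = φ (f z).1 * t := by
    intro z hz
    rcases hm.edge P' z hz with h | h <;> obtain ⟨c, d, hcd, h⟩ := hφ.exists_swap h
    · exact ⟨_, ⟨c, d, hcd, rfl⟩, by rw [h, mul_swap_mul_self]⟩
    · exact ⟨_, ⟨c, d, hcd, rfl⟩, h⟩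
  have hz : ∃ z z' : W, φ z = φ P * swap i j * swap j k ∧ φ z' = φ P * swap j k * swap i j ∧
      cs.length z = cs.length a.1 + 1 ∧ (∃ t : Perm (Fin n), t.IsSwap ∧ φ (f P').1 = φ z * t) ∧
      ∃ t : Perm (Fin n), t.IsSwap ∧ φ (f P').1 = φ z' * t := by
    rcases hy with ⟨h1, h2⟩ | ⟨h1, h2⟩
    · exact ⟨_, _, h1, h2, la', hadj b ePb, hadj a ePa⟩
    · exact ⟨_, _, h2, h1, la, hadj a ePa, hadj b ePb⟩
  obtain ⟨z, z', hz, hz', lz, ⟨t, ht, htm⟩, ⟨t', ht', htm'⟩⟩ := hz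
  have hik : i ≠ k := (hij.trans hjk).ne
  obtain ⟨c1, c2⟩ := swap_mul_swap_cycle hij.ne hik hjk.ne
  have hprod : swap i j * swap j k = t * t' := by
    have e1 : swap j k * swap i j = swap i j * swap k i := by
      simpa using congrArg Inv.inv c2
    have e2 : swap j k * swap i j = swap k i * swap j k := by
      simpa using congrArg Inv.inv c1
    have h1 : swap i j * swap j k * t = swap j k * swap i j * t' := by
      have := htm.symm.trans htm'
      rw [hz, hz'] at this
      simp only [mul_assoc] at this ⊢
      exact mul_left_cancel this
    have h2 : t' * t' = 1 := by
      obtain ⟨c, d, -, rfl⟩ := ht'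
      exact swap_mul_self c d
    have h3 : t = swap j k * swap i j * (swap j k * swap i j) * t' := by
      rw [mul_assoc _ _ t', ← h1]
      simp [mul_assoc]
    have h4 : swap j k * swap i j * (swap j k * swap i j) = swap i j * swap j k := by
      nth_rw 1 [e1]
      rw [e2]
      simp [mul_assoc]
    rw [h3, h4, mul_assoc, h2, mul_one]
  have hne : ∀ w : cs.BruhatInterval u v, cs.length P < cs.length w.1 →
      cs.length w.1 < cs.length (f w).1 → φ (f P').1 ≠ φ w.1 := by
    intro w h1 h2 e
    have : f P' = w := Subtype.ext (φ.injective e)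
    rw [← this, hm.involutive] at h2
    rw [this] at h2
    exact h1.asymm h2
  rcases eq_of_swap_mul_swap_eq_cycle hij.ne hik hjk.ne ht ht' hprod
    with ⟨h, -⟩ | ⟨h, -⟩ | ⟨h, -⟩
  · rw [h] at htm
    have e := (hφ.bruhatEdge_iff hij.ne htm).2 (iff_of_true hij (by
      rw [hz]
      simpa [swap_apply_of_ne_of_ne hij.ne hik, swap_apply_of_ne_of_ne hik.symm hjk.ne'] using hp'))
    have := e.length_lt
    omega
  · refine hne a lP (by omega) ?_
    rw [htm, hz, h, ha, mul_swap_mul_self]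
  · refine hne b (by omega) (by omega) ?_
    rw [htm, hz, h, hb', mul_assoc (φ P), c1, ← mul_assoc, mul_swap_mul_self]

end CoxeterSystem

theorem proposition6p4 {B W : Type*} [Group W] {M : CoxeterMatrix B} (cs : CoxeterSystem M W)
    (hW : cs.IsRightAngled ∨ cs.IsSymmetricGroup)
    (u v : W) (huv : cs.BruhatLE u v)
    (f : cs.BruhatInterval u v → cs.BruhatInterval u v)
    (hf : IsPerfectMatchingMap (SimpleGraph.hasse (cs.BruhatInterval u v)) f)
    (hauto : ∃ φ : cs.bruhatIntervalGraph u v ≃g cs.bruhatIntervalGraph u v, ⇑φ = f) :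
    IsSpecialMatching f := by
  have hm := CoxeterSystem.IsBruhatMatching.of_automorphism hf hauto
  refine CoxeterSystem.isSpecialMatching_of_not_isButterfly hf hm ?_
  rcases hW with hW | ⟨n, φ, hφ⟩
  · exact hW.not_isButterfly hm
  · exact CoxeterSystem.IsStandardIso.not_isButterfly (φ := φ) hφ hm
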